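/- Let $k$ be an algebraically closed field of characteristic $0$, let $p,q$ be prime numbers (not necessarily distinct), and give $B=k[U,V,W]$ the standard grading. For $f,g\in B$ let $\Delta_{(f,g)}$ be the derivation $b\mapsto \det\frac{\partial(f,g,b)}{\partial(U,V,W)}$ of $B$. For a locally nilpotent $k$-derivation $D$ of $B$ put $\deg_D(b)=\max\{n\ge 0: D^n(b)\neq 0\}$ for $b\ne0$ and $\deg_D(0)=-\infty$. A system of variables of $B$ is a triple $(X_1,X_2,X_3)$ with $k[X_1,X_2,X_3]=B$; it is linear if each $X_i$ is a linear form. The rank of $D$ is the least number of variables not annihilated by $D$, over all systems of variables; $D$ is irreducible if $D(B)$ lies in no proper principal ideal; and $D$ is triangularizable if there is a system of variables with $DX_i\in k[X_1,\dots,X_{i-1}]$ for $i=1,2,3$. Let $D$ be an irreducible homogeneous locally nilpotent $k$-derivation of $B$ of rank $2$ and degree $pq-2$ (that is, $D$ maps forms of degree $m$ to forms of degree $m+pq-2$). Then $D$ is not triangularizable if and only if, for $(r,s)=(p,q)$ or $(r,s)=(q,p)$, there exist a linear system of variables $\{X,Y,Z\}$ of $B$, a homogeneous polynomial $h(X,Y)$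 of degree $s$ that is monic in $Y$, and constants $\gamma\in k^*$, $c_1,\dots,c_r\in k$ with $c_r\neq 0$, such that $D=\gamma\,\Delta_{(X,P)}$, where $$P=\tilde Z^{\,r}+c_1X^{s}\tilde Z^{\,r-1}+\dots+c_{r-1}X^{rs-s}\tilde Z+c_rX^{rs-1}Y,\qquad \tilde Z=h(X,Y)+X^{s-1}Z,$$ and $0=\deg_D(X)<\deg_D(Y)<\deg_D(Z)$. Moreover, whenever $D=\gamma\,\Delta_{(X,P)}$ with such $(r,s)$, $X,Y,Z,h,\gamma,c_i$ and $P$, one has $\deg_D(X)=0$, $\deg_D(Y)=r$ and $\deg_D(Z)=rs$ (so the inequalities above hold automatically). -/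

import Mathlib

open MvPolynomial

namespace PolyLND

section General

variable {k : Type*} [Field k] {n : ℕ}

/-- `D` is a locally nilpotent derivation of the polynomial ring `k[x₁, …, xₙ]`. -/
def IsLocallyNilpotent (D : Derivation k (MvPolynomial (Fin n) k) (MvPolynomial (Fin n) k)) :
    Prop :=
  ∀ b, ∃ m : ℕ, (⇑D)^[m] b = 0

/-- `D` is homogeneous of degree `d` for the standard grading (all variables of weight one):
it maps forms of degree `m` to forms of degree `m + d`. -/
def IsHomogeneousOfDegree
    (D : Derivation k (MvPolynomial (Fin n) k) (MvPolynomial (Fin n) k)) (d : ℕ) : Prop :=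
  ∀ (m : ℕ) (b : MvPolynomial (Fin n) k), b.IsHomogeneous m → (D b).IsHomogeneous (m + d)

/-- `D` is irreducible: its image lies in no proper principal ideal. -/
def IsIrreducible (D : Derivation k (MvPolynomial (Fin n) k) (MvPolynomial (Fin n) k)) : Prop :=
  ∀ b : MvPolynomial (Fin n) k, (∀ a, b ∣ D a) → IsUnit b

/-- `v` is a system of variables (coordinates): `k[v₁, …, vₙ] = k[x₁, …, xₙ]`, that is, the
substitution `xᵢ ↦ vᵢ` is an automorphism. -/
def IsCoordinateSystem (v : Fin n → MvPolynomial (Fin n) k) : Prop :=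
  Function.Bijective (aeval v : MvPolynomial (Fin n) k →ₐ[k] MvPolynomial (Fin n) k)

/-- A system of variables consisting of linear forms. -/
def IsLinearCoordinateSystem (v : Fin n → MvPolynomial (Fin n) k) : Prop :=
  IsCoordinateSystem v ∧ ∀ i, (v i).IsHomogeneous 1

/-- The rank of `D`: the least number of variables not annihilated by `D`, over all systems of
variables. -/
noncomputable def rank (D : Derivation k (MvPolynomial (Fin n) k) (MvPolynomial (Fin n) k)) : ℕ :=
  sInf {r : ℕ | ∃ v : Fin n → MvPolynomial (Fin n) k,
    IsCoordinateSystem v ∧ {i : Fin n | D (v i) ≠ 0}.ncard = r}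

/-- `D` is triangularizable: in some system of variables `v₁, …, vₙ`, one has
`D vᵢ ∈ k[v₁, …, vᵢ₋₁]` for all `i`. -/
def IsTriangularizable (D : Derivation k (MvPolynomial (Fin n) k) (MvPolynomial (Fin n) k)) :
    Prop :=
  ∃ v : Fin n → MvPolynomial (Fin n) k, IsCoordinateSystem v ∧
    ∀ i, D (v i) ∈ Algebra.adjoin k (v '' {j | j < i})

open Classical in
/-- The degree function of a locally nilpotent derivation: `deg_D 0 = -∞`, and
`deg_D b = max {m | D^m b ≠ 0}` for `b ≠ 0` (a finite set when `D` is locally nilpotent). -/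
noncomputable def degD (D : Derivation k (MvPolynomial (Fin n) k) (MvPolynomial (Fin n) k))
    (b : MvPolynomial (Fin n) k) : WithBot ℕ :=
  if b = 0 then ⊥ else ((sSup {m : ℕ | (⇑D)^[m] b ≠ 0} : ℕ) : WithBot ℕ)

end General

section Three

variable {k : Type*} [Field k]

/-- The Jacobian derivation `Δ_(f,g) = det ∂(f, g, ·)/∂(U, V, W)` of `k[U, V, W]`, the determinant
being expanded along its last row (see `jacobianDerivation_eq_det`). -/
noncomputable def jacobianDerivation (f g : MvPolynomial (Fin 3) k) :
    Derivation k (MvPolynomial (Fin 3) k) (MvPolynomial (Fin 3) k) :=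
  (pderiv 1 f * pderiv 2 g - pderiv 2 f * pderiv 1 g) • pderiv 0 +
  (pderiv 2 f * pderiv 0 g - pderiv 0 f * pderiv 2 g) • pderiv 1 +
  (pderiv 0 f * pderiv 1 g - pderiv 1 f * pderiv 0 g) • pderiv 2

theorem jacobianDerivation_eq_det (f g b : MvPolynomial (Fin 3) k) :
    jacobianDerivation f g b =
      Matrix.det (Matrix.of fun i j : Fin 3 => pderiv j (![f, g, b] i)) := by
  simp [jacobianDerivation, Matrix.det_fin_three]
  ring

/-- `Z̃ = h(X, Y) + X^(q-1) Z`. -/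
noncomputable def tildeZ (q : ℕ) (h : MvPolynomial (Fin 2) k) (X Y Z : MvPolynomial (Fin 3) k) :
    MvPolynomial (Fin 3) k :=
  aeval ![X, Y] h + X ^ (q - 1) * Z

/-- `P = Z̃^p + c₁ X^q Z̃^(p-1) + ⋯ + c_(p-1) X^(pq-q) Z̃ + c_p X^(pq-1) Y`. -/
noncomputable def normalP (p q : ℕ) (h : MvPolynomial (Fin 2) k) (c : ℕ → k)
    (X Y Z : MvPolynomial (Fin 3) k) : MvPolynomial (Fin 3) k :=
  tildeZ q h X Y Z ^ p +
    ∑ i ∈ Finset.Icc 1 (p - 1), C (c i) * X ^ (i * q) * tildeZ q h X Y Z ^ (p - i) +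
    C (c p) * X ^ (p * q - 1) * Y

/-- `D = γ Δ_(X,P)` with `{X, Y, Z}` a linear system of variables, `γ ∈ k*`, and `P` the
polynomial `normalP` for a form `h(X, Y)` of degree `q`, monic in `Y` (so that the leading term in
`Y` is `Y^q`), and constants `cᵢ` with `c_p ≠ 0`. -/
structure IsNormalForm (p q : ℕ)
    (D : Derivation k (MvPolynomial (Fin 3) k) (MvPolynomial (Fin 3) k))
    (γ : k) (h : MvPolynomial (Fin 2) k) (c : ℕ → k) (X Y Z : MvPolynomial (Fin 3) k) :
    Prop where
  linear : IsLinearCoordinateSystem ![X, Y, Z]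
  unit_ne_zero : γ ≠ 0
  homogeneous : h.IsHomogeneous q
  monic : h.coeff (Finsupp.single 1 q) = 1
  last_ne_zero : c p ≠ 0
  eq_smul : D = γ • jacobianDerivation X (normalP p q h c X Y Z)

end Three

end PolyLND

/-! A homogeneous derivation that kills a variable kills its linear part, so rank two yields a
linear form X with D X = 0. Setting X = 1 loses nothing on forms of known degree and turns D into an
irreducible locally nilpotent derivation δ of k[y, z]. By Rentschler's theorem
(`exists_variable_apply_eq_zero`) δ kills a variable g. Irreducibility makes δ a constant multiple
of the Jacobian derivation of g and forces deg g = pq (`Dehom.totalDegree_eq`).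

The shape of g is read off its Newton polygon. Leading forms of g are killed by a nonzero locally
nilpotent derivation, whose kernel is factorially closed; hence the leading form along the edge is a
power of y^b - l z^a with a = 1 or b = 1 (`exists_leading_form`). Successive shears z ↦ z + h(y)
therefore bring g to some F with deg_y F < r, where r = deg_z g = deg_z F and pq = r · deg h. The
coordinates are chosen with deg_z g < deg_y g, so that s = deg h is at least 2. If F is free of y,
it is linear in z and D is triangular. Otherwise deg_y F is a divisor of r smaller than r, so r ≥ 2;
then r and s are the two primes and deg_y F = 1. Thus F = c y + u(z) and g = c y + u(z - h(y)),
whose homogenization is P up to scaling and an additive constant (`exists_isNormalForm`).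

Conversely, deg_D is additive on products. For a normal form Z̃ has degree 1 and P has degree 0, and
comparing terms gives the degrees 0, r, rs of X, Y, Z. A triangularizing system contains two
variables killed by D², and their independent linear parts are killed by D² too; since r ≥ 2, every
such linear form is a multiple of X, a contradiction. -/

namespace PolyLND

/-! ### Degree with respect to a locally nilpotent derivation. -/

section Iterates

variable {k R : Type*} [Field k] [CommRing R] [Algebra k R]

/-- `b` has degree exactly `i` with respect to `δ`. -/
def HasTop (δ : Derivation k R R) (b : R) (i : ℕ) : Prop :=
  (⇑δ)^[i] b ≠ 0 ∧ (⇑δ)^[i + 1] b = 0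

variable (δ : Derivation k R R)

theorem iterate_eq_pow (i : ℕ) (b : R) : (⇑δ)^[i] b = ((δ : R →ₗ[k] R) ^ i) b := by
  rw [Module.End.pow_apply]; rfl

theorem iterate_add_right (i : ℕ) (a b : R) : (⇑δ)^[i] (a + b) = (⇑δ)^[i] a + (⇑δ)^[i] b := by
  simp [iterate_eq_pow]

theorem iterate_sub_right (i : ℕ) (a b : R) : (⇑δ)^[i] (a - b) = (⇑δ)^[i] a - (⇑δ)^[i] b := by
  simp [iterate_eq_pow]

theorem iterate_smul_right (i : ℕ) (c : k) (b : R) : (⇑δ)^[i] (c • b) = c • (⇑δ)^[i] b := by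
  simp [iterate_eq_pow]

theorem iterate_sum_right {ι : Type*} (s : Finset ι) (f : ι → R) (i : ℕ) :
    (⇑δ)^[i] (∑ j ∈ s, f j) = ∑ j ∈ s, (⇑δ)^[i] (f j) := by
  simp [iterate_eq_pow]

theorem iterate_zero_right (i : ℕ) : (⇑δ)^[i] 0 = 0 := by
  simp

variable {δ}

theorem iterate_eq_zero_of_le {b : R} {i j : ℕ} (h : (⇑δ)^[i] b = 0) (hij : i ≤ j) :
    (⇑δ)^[j] b = 0 := by
  obtain ⟨l, rfl⟩ := Nat.exists_eq_add_of_le' hij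
  rw [Function.iterate_add_apply, h, iterate_zero_right]

theorem HasTop.iterate_eq_zero {b : R} {i j : ℕ} (h : HasTop δ b i) (hij : i < j) :
    (⇑δ)^[j] b = 0 :=
  iterate_eq_zero_of_le h.2 hij

theorem HasTop.unique {b : R} {i j : ℕ} (hi : HasTop δ b i) (hj : HasTop δ b j) : i = j := by
  by_contra hne
  rcases lt_or_gt_of_ne hne with h | h
  · exact hj.1 (hi.iterate_eq_zero h)
  · exact hi.1 (hj.iterate_eq_zero h)

theorem HasTop.ne_zero {b : R} {i : ℕ} (h : HasTop δ b i) : b ≠ 0 := by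
  rintro rfl
  exact h.1 (iterate_zero_right δ i)

theorem exists_hasTop {b : R} (hb : b ≠ 0) (h : ∃ m, (⇑δ)^[m] b = 0) : ∃ i, HasTop δ b i := by
  classical
  obtain ⟨i, hi⟩ : ∃ i, Nat.find h = i + 1 := by
    refine Nat.exists_eq_succ_of_ne_zero fun h0 => hb ?_
    simpa [h0] using Nat.find_spec h
  exact ⟨i, Nat.find_min h (by omega), hi ▸ Nat.find_spec h⟩

theorem hasTop_zero_iff {b : R} : HasTop δ b 0 ↔ b ≠ 0 ∧ δ b = 0 := by
  simp [HasTop]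

theorem HasTop.add_of_iterate_eq_zero {a b : R} {i : ℕ} (ha : HasTop δ a i)
    (hb : (⇑δ)^[i] b = 0) : HasTop δ (a + b) i := by
  refine ⟨?_, ?_⟩
  · rw [iterate_add_right, hb, add_zero]; exact ha.1
  · rw [iterate_add_right, ha.2, iterate_eq_zero_of_le hb (Nat.le_succ i), add_zero]

theorem HasTop.of_succ {b : R} {i : ℕ} (h : HasTop δ (δ b) i) : HasTop δ b (i + 1) := h

theorem HasTop.pred {b : R} {i : ℕ} (h : HasTop δ b i) (hb : δ b ≠ 0) :
    ∃ j, i = j + 1 ∧ HasTop δ (δ b) j := by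
  rcases i with _ | j
  · exact absurd h.2 hb
  · exact ⟨j, rfl, h⟩

/-- In the general Leibniz formula for the iterate of order i + j only the (i, j) term survives. The
induction on i + j gets its binomial coefficient from Pascal's rule. -/
theorem iterate_mul_eq (i j : ℕ) (a b : R) (ha : (⇑δ)^[i + 1] a = 0) (hb : (⇑δ)^[j + 1] b = 0) :
    (⇑δ)^[i + j] (a * b) = ((i + j).choose i : R) * ((⇑δ)^[i] a * (⇑δ)^[j] b) ∧
      (⇑δ)^[i + j + 1] (a * b) = 0 := by
  suffices h : ∀ (n i j : ℕ) (a b : R), i + j = n → (⇑δ)^[i + 1] a = 0 → (⇑δ)^[j + 1] b = 0 →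
      (⇑δ)^[i + j] (a * b) = ((i + j).choose i : R) * ((⇑δ)^[i] a * (⇑δ)^[j] b) ∧
        (⇑δ)^[i + j + 1] (a * b) = 0 from h _ i j a b rfl ha hb
  intro n
  induction n with
  | zero =>
    intro i j a b hij ha hb
    obtain ⟨rfl, rfl⟩ : i = 0 ∧ j = 0 := by omega
    simp only [zero_add, Function.iterate_one] at ha hb
    simp [ha, hb]
  | succ n ih =>
    intro i j a b hij ha hb
    have hD : δ (a * b) = a * δ b + δ a * b := by simp [mul_comm]
    rcases i with _ | i
    · simp only [zero_add, Function.iterate_one] at ha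
      obtain ⟨j, rfl⟩ : ∃ l, j = l + 1 := ⟨n, by omega⟩
      have := ih 0 j a (δ b) (by omega) (by simpa using ha) hb
      simp only [zero_add, Nat.choose_zero_right] at this ⊢
      rw [Function.iterate_succ_apply _ j (a * b), Function.iterate_succ_apply _ (j + 1) (a * b),
        hD, ha, zero_mul, add_zero]
      exact this
    rcases j with _ | j
    · simp only [zero_add, Function.iterate_one] at hb
      have := ih i 0 (δ a) b (by omega) ha (by simpa using hb)
      simp only [add_zero, Nat.choose_self] at this ⊢
      rw [Function.iterate_succ_apply _ i (a * b), Function.iterate_succ_apply _ (i + 1) (a * b),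
        hD, hb, mul_zero, zero_add]
      exact this
    · have h1 := ih (i + 1) j a (δ b) (by omega) ha hb
      have h2 := ih i (j + 1) (δ a) b (by omega) ha hb
      have e1 : i + 1 + (j + 1) = (i + 1 + j) + 1 := by ring
      have e2 : i + (j + 1) = i + 1 + j := by ring
      rw [e2] at h2
      rw [e1, Function.iterate_succ_apply, Function.iterate_succ_apply _ (_ + 1), hD,
        iterate_add_right, iterate_add_right, h1.1, h1.2, h2.1, h2.2]
      refine ⟨?_, by simp⟩
      rw [Nat.choose_succ_succ]
      push_cast
      simp only [Function.iterate_succ_apply]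
      ring

variable [CharZero k] [IsDomain R]

/-- Additivity of the degree: the binomial coefficient is nonzero in characteristic 0, and the two
top iterates multiply to something nonzero in a domain. -/
theorem HasTop.mul {a b : R} {i j : ℕ} (ha : HasTop δ a i) (hb : HasTop δ b j) :
    HasTop δ (a * b) (i + j) := by
  have : CharZero R := charZero_of_injective_algebraMap (algebraMap k R).injective
  have h := iterate_mul_eq i j a b ha.2 hb.2
  refine ⟨?_, h.2⟩
  rw [h.1]
  refine mul_ne_zero ?_ (mul_ne_zero ha.1 hb.1)
  exact_mod_cast (Nat.choose_pos (Nat.le_add_right i j)).ne'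

theorem HasTop.pow {a : R} {i : ℕ} (ha : HasTop δ a i) (n : ℕ) : HasTop δ (a ^ n) (n * i) := by
  induction n with
  | zero => simp [HasTop]
  | succ n ih => rw [pow_succ, Nat.succ_mul]; exact ih.mul ha

/-- The kernel is factorially closed: degrees are nonnegative and add up to 0. -/
theorem apply_eq_zero_of_mul (hδ : ∀ b, ∃ m, (⇑δ)^[m] b = 0) {a b : R} (hab : a * b ≠ 0)
    (h : δ (a * b) = 0) : δ a = 0 := by
  obtain ⟨i, hi⟩ := exists_hasTop (left_ne_zero_of_mul hab) (hδ a)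
  obtain ⟨j, hj⟩ := exists_hasTop (right_ne_zero_of_mul hab) (hδ b)
  have := (hi.mul hj).unique (hasTop_zero_iff.2 ⟨hab, h⟩)
  obtain rfl : i = 0 := by omega
  exact hi.2

theorem apply_eq_zero_of_dvd (hδ : ∀ b, ∃ m, (⇑δ)^[m] b = 0) {a b : R} (hb : b ≠ 0)
    (h : δ b = 0) (hab : a ∣ b) : δ a = 0 := by
  obtain ⟨c, rfl⟩ := hab
  exact apply_eq_zero_of_mul hδ hb h

/-- If neither image vanished, the divisibilities would give deg b ≤ deg a - 1 and deg a ≤ deg b -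
1. -/
theorem apply_eq_zero_of_cross_dvd (hδ : ∀ b, ∃ m, (⇑δ)^[m] b = 0) {a b : R}
    (hab : b ∣ δ a) (hba : a ∣ δ b) : δ a = 0 ∨ δ b = 0 := by
  by_contra! hne
  obtain ⟨c, hc⟩ := hab
  obtain ⟨d, hd⟩ := hba
  have ha0 : a ≠ 0 := fun h => hne.1 (by simp [h])
  have hb0 : b ≠ 0 := fun h => hne.2 (by simp [h])
  obtain ⟨i, hi⟩ := exists_hasTop ha0 (hδ a)
  obtain ⟨j, hj⟩ := exists_hasTop hb0 (hδ b)
  obtain ⟨i', rfl, hi'⟩ := hi.pred hne.1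
  obtain ⟨j', rfl, hj'⟩ := hj.pred hne.2
  obtain ⟨l, hl⟩ := exists_hasTop (right_ne_zero_of_mul (hc ▸ hne.1)) (hδ c)
  obtain ⟨m, hm⟩ := exists_hasTop (right_ne_zero_of_mul (hd ▸ hne.2)) (hδ d)
  have h1 := hi'.unique (hc ▸ hj.mul hl)
  have h2 := hj'.unique (hd ▸ hi.mul hm)
  omega

end Iterates

/-! ### Conjugating a derivation by an automorphism. -/

section Conjugation

variable {k R : Type*} [Field k] [CommRing R] [Algebra k R]

/-- The derivation `τ δ τ⁻¹`. -/
def conj (τ : R ≃ₐ[k] R) (δ : Derivation k R R) : Derivation k R R :=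
  Derivation.mk' (τ.toLinearMap ∘ₗ (δ : R →ₗ[k] R) ∘ₗ τ.symm.toLinearMap) (by
    intro a b
    simp)

theorem conj_apply (τ : R ≃ₐ[k] R) (δ : Derivation k R R) (b : R) :
    conj τ δ b = τ (δ (τ.symm b)) := rfl

theorem conj_apply_apply (τ : R ≃ₐ[k] R) (δ : Derivation k R R) (b : R) :
    conj τ δ (τ b) = τ (δ b) := by
  rw [conj_apply, AlgEquiv.symm_apply_apply]

theorem iterate_conj (τ : R ≃ₐ[k] R) (δ : Derivation k R R) (i : ℕ) (b : R) :
    (⇑(conj τ δ))^[i] (τ b) = τ ((⇑δ)^[i] b) := by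
  induction i generalizing b with
  | zero => rfl
  | succ i ih => rw [Function.iterate_succ_apply, Function.iterate_succ_apply, conj_apply_apply, ih]

theorem conj_locallyNilpotent (τ : R ≃ₐ[k] R) {δ : Derivation k R R}
    (hδ : ∀ b, ∃ m, (⇑δ)^[m] b = 0) (b : R) : ∃ m, (⇑(conj τ δ))^[m] b = 0 := by
  obtain ⟨m, hm⟩ := hδ (τ.symm b)
  refine ⟨m, ?_⟩
  have := iterate_conj τ δ m (τ.symm b)
  rwa [AlgEquiv.apply_symm_apply, hm, map_zero] at this

theorem conj_ne_zero (τ : R ≃ₐ[k] R) {δ : Derivation k R R} (hδ : δ ≠ 0) : conj τ δ ≠ 0 := by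
  intro h
  refine hδ (Derivation.ext fun b => τ.injective ?_)
  rw [← conj_apply_apply, h]
  simp

end Conjugation

/-! ### Chain rule, Jacobian matrices and linear systems of variables. -/

section Coordinates

variable {k : Type*} [Field k] {n : ℕ}

theorem derivation_aeval {σ S : Type*} [Fintype σ] [CommRing S] [Algebra k S]
    (d : Derivation k S S) (v : σ → S) (p : MvPolynomial σ k) :
    d (aeval v p) = ∑ l, aeval v (pderiv l p) * d (v l) := by
  classical
  induction p using MvPolynomial.induction_on with
  | C a => simp
  | add p q hp hq => simp [hp, hq, add_mul, Finset.sum_add_distrib]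
  | mul_X p i hp =>
    have h : ∀ l, aeval v (pderiv l (p * X i)) * d (v l) =
        v i * (aeval v (pderiv l p) * d (v l)) + aeval v p * (if l = i then d (v i) else 0) := by
      intro l
      rw [Derivation.leibniz, pderiv_X]
      by_cases hl : l = i
      · subst hl; simp; ring
      · rw [Pi.single_eq_of_ne (Ne.symm hl)]
        simp [hl]; ring
    simp only [h, Finset.sum_add_distrib, ← Finset.mul_sum, ← hp]
    simp [add_comm]

/-- The Jacobian matrix of a tuple of polynomials. -/
noncomputable def jacobianMatrix (v : Fin n → MvPolynomial (Fin n) k) :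
    Matrix (Fin n) (Fin n) (MvPolynomial (Fin n) k) :=
  Matrix.of fun i j => pderiv j (v i)

theorem pderiv_aeval (v : Fin n → MvPolynomial (Fin n) k) (p : MvPolynomial (Fin n) k)
    (j : Fin n) :
    pderiv j (aeval v p) = ∑ l, aeval v (pderiv l p) * pderiv j (v l) :=
  derivation_aeval (pderiv j) v p

/-- By the chain rule, differentiating the expression of each `X i` as a polynomial in `v` exhibits
a left inverse of the Jacobian matrix. -/
theorem IsCoordinateSystem.isUnit_det {v : Fin n → MvPolynomial (Fin n) k}
    (hv : IsCoordinateSystem v) : IsUnit (jacobianMatrix v).det := by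
  choose w hw using fun i => hv.2 (X i)
  have h : (Matrix.of fun i l => aeval v (pderiv l (w i))) * jacobianMatrix v = 1 := by
    ext1 i j
    rw [Matrix.mul_apply, Matrix.one_apply]
    simp only [Matrix.of_apply, jacobianMatrix, ← pderiv_aeval, hw]
    rw [pderiv_X, Pi.single_apply]
  exact IsUnit.of_mul_eq_one_right _ (by rw [← Matrix.det_mul, h, Matrix.det_one])

theorem homogeneousComponent_one_eq (p : MvPolynomial (Fin n) k) :
    homogeneousComponent 1 p = ∑ j, C (coeff (Finsupp.single j 1) p) * X j := by
  classical
  ext m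
  rw [coeff_homogeneousComponent, coeff_sum]
  simp only [coeff_C_mul, coeff_X, mul_ite, mul_one, mul_zero]
  split_ifs with h
  · obtain ⟨i, rfl⟩ : ∃ i, m = Finsupp.single i 1 := by
      rw [Finsupp.degree_eq_sum] at h
      obtain ⟨i, -, hi⟩ := Finset.exists_ne_zero_of_sum_ne_zero (h.trans_ne one_ne_zero)
      refine ⟨i, Finsupp.ext fun j => ?_⟩
      rw [← Finset.add_sum_erase _ _ (Finset.mem_univ i)] at h
      by_cases hj : j = i
      · subst hj
        rw [Finsupp.single_eq_same]; omega
      · have : m j ≤ ∑ x ∈ Finset.univ.erase i, m x :=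
          Finset.single_le_sum (f := fun x => m x) (fun _ _ => Nat.zero_le _)
            (Finset.mem_erase.2 ⟨hj, Finset.mem_univ j⟩)
        rw [Finsupp.single_eq_of_ne hj]; omega
    rw [Finset.sum_eq_single i]
    · simp
    · intro j _ hj
      rw [if_neg]
      intro he
      exact hj ((Finsupp.single_left_injective one_ne_zero) he)
    · simp
  · refine (Finset.sum_eq_zero fun j _ => if_neg ?_).symm
    rintro rfl
    simp at h

theorem IsHomogeneous.eq_sum {p : MvPolynomial (Fin n) k} (hp : p.IsHomogeneous 1) :
    p = ∑ j, C (coeff (Finsupp.single j 1) p) * X j := by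
  rw [← homogeneousComponent_one_eq]
  exact (homogeneousComponent_eq_self hp).symm

/-- The tuple of linear forms with coefficient matrix `M`. -/
noncomputable def linearForms (M : Matrix (Fin n) (Fin n) k) (i : Fin n) :
    MvPolynomial (Fin n) k :=
  ∑ j, C (M i j) * X j

theorem linearForms_isHomogeneous (M : Matrix (Fin n) (Fin n) k) (i : Fin n) :
    (linearForms M i).IsHomogeneous 1 :=
  IsHomogeneous.sum _ _ _ fun _ _ => isHomogeneous_C_mul_X _ _

theorem aeval_linearForms (M N : Matrix (Fin n) (Fin n) k) (i : Fin n) :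
    aeval (linearForms M) (linearForms N i) = linearForms (N * M) i := by
  simp only [linearForms, map_sum, map_mul, algHom_C, aeval_X, Matrix.mul_apply, Finset.mul_sum,
    Finset.sum_mul, algebraMap_eq]
  rw [Finset.sum_comm]
  simp only [mul_assoc]

theorem linearForms_one (i : Fin n) : linearForms (1 : Matrix (Fin n) (Fin n) k) i = X i := by
  simp [linearForms, Matrix.one_apply]

theorem aeval_linearForms_aeval {M N : Matrix (Fin n) (Fin n) k} (h : N * M = 1)
    (p : MvPolynomial (Fin n) k) : aeval (linearForms M) (aeval (linearForms N) p) = p := by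
  have : (aeval (linearForms M)).comp (aeval (linearForms N)) = AlgHom.id k _ := by
    refine MvPolynomial.algHom_ext fun i => ?_
    rw [AlgHom.comp_apply, aeval_X, aeval_linearForms, h, linearForms_one, AlgHom.id_apply]
  rw [← AlgHom.comp_apply, this, AlgHom.id_apply]

theorem isLinearCoordinateSystem_linearForms {M N : Matrix (Fin n) (Fin n) k} (hMN : M * N = 1) :
    IsLinearCoordinateSystem (linearForms M) :=
  ⟨⟨Function.LeftInverse.injective (aeval_linearForms_aeval hMN),
    Function.RightInverse.surjective (aeval_linearForms_aeval (mul_eq_one_comm.1 hMN))⟩,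
    linearForms_isHomogeneous M⟩

/-- The coefficient matrix of the linear parts is the Jacobian matrix at the origin, and its
determinant is the value there of a unit. This is what reduces arbitrary systems of variables to
linear ones. -/
theorem IsCoordinateSystem.exists_linearPart {v : Fin n → MvPolynomial (Fin n) k}
    (hv : IsCoordinateSystem v) :
    ∃ M N : Matrix (Fin n) (Fin n) k, M * N = 1 ∧
      ∀ i, homogeneousComponent 1 (v i) = linearForms M i := by
  let M : Matrix (Fin n) (Fin n) k := (jacobianMatrix v).map constantCoeff
  have hM : IsUnit M.det := by
    have : M.det = constantCoeff (jacobianMatrix v).det := by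
      rw [RingHom.map_det]; rfl
    rw [this]
    exact hv.isUnit_det.map _
  refine ⟨M, M⁻¹, Matrix.mul_nonsing_inv M hM, fun i => ?_⟩
  rw [homogeneousComponent_one_eq, linearForms]
  refine Finset.sum_congr rfl fun j _ => ?_
  have : M i j = coeff (Finsupp.single j 1) (v i) := by
    change coeff 0 (pderiv j (v i)) = _
    rw [coeff_pderiv]
    simp
  rw [this]

theorem IsLinearCoordinateSystem.exists_matrix {v : Fin n → MvPolynomial (Fin n) k}
    (hv : IsLinearCoordinateSystem v) :
    ∃ M N : Matrix (Fin n) (Fin n) k, M * N = 1 ∧ v = linearForms M := by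
  obtain ⟨M, N, hMN, h⟩ := hv.1.exists_linearPart
  refine ⟨M, N, hMN, funext fun i => ?_⟩
  rw [← h i, homogeneousComponent_eq_self (hv.2 i)]

theorem IsLinearCoordinateSystem.exists_inverse {v : Fin n → MvPolynomial (Fin n) k}
    (hv : IsLinearCoordinateSystem v) :
    ∃ w : Fin n → MvPolynomial (Fin n) k, IsLinearCoordinateSystem w ∧
      (∀ p, aeval v (aeval w p) = p) ∧ ∀ p, aeval w (aeval v p) = p := by
  obtain ⟨M, N, hMN, rfl⟩ := hv.exists_matrix
  have hNM : N * M = 1 := mul_eq_one_comm.1 hMN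
  exact ⟨linearForms N, isLinearCoordinateSystem_linearForms hNM, aeval_linearForms_aeval hNM,
    aeval_linearForms_aeval hMN⟩

theorem aeval_isHomogeneous {m : ℕ} {v : Fin m → MvPolynomial (Fin n) k}
    (hv : ∀ i, (v i).IsHomogeneous 1) {p : MvPolynomial (Fin m) k} {d : ℕ}
    (hp : p.IsHomogeneous d) : (aeval v p).IsHomogeneous d := by
  simpa using hp.aeval v hv

theorem IsLinearCoordinateSystem.comp {v w : Fin n → MvPolynomial (Fin n) k}
    (hv : IsLinearCoordinateSystem v) (hw : IsLinearCoordinateSystem w) :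
    IsLinearCoordinateSystem fun i => aeval v (w i) := by
  refine ⟨?_, fun i => aeval_isHomogeneous hv.2 (hw.2 i)⟩
  have : (aeval fun i => aeval v (w i) : MvPolynomial (Fin n) k →ₐ[k] _) =
      (aeval v).comp (aeval w) := MvPolynomial.algHom_ext fun i => by
      rw [AlgHom.comp_apply, aeval_X, aeval_X]
  rw [IsCoordinateSystem, this]
  exact hv.1.comp hw.1

theorem IsLinearCoordinateSystem.det_eq {v : Fin n → MvPolynomial (Fin n) k}
    (hv : IsLinearCoordinateSystem v) :
    ∃ κ : k, κ ≠ 0 ∧ (jacobianMatrix v).det = C κ := by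
  obtain ⟨κ, hκ, h⟩ := (MvPolynomial.isUnit_iff_eq_C_of_isReduced (P := (jacobianMatrix v).det)).1
    hv.1.isUnit_det
  exact ⟨κ, hκ.ne_zero, h⟩

end Coordinates

/-! ### Jacobian derivations under substitution. -/

section Jacobian

variable {k : Type*} [Field k]

theorem jacobianDerivation_aeval (v : Fin 3 → MvPolynomial (Fin 3) k)
    (f g b : MvPolynomial (Fin 3) k) :
    jacobianDerivation (aeval v f) (aeval v g) (aeval v b) =
      (jacobianMatrix v).det * aeval v (jacobianDerivation f g b) := by
  rw [jacobianDerivation_eq_det, jacobianDerivation_eq_det, mul_comm, AlgHom.map_det,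
    ← Matrix.det_mul]
  congr 1
  ext1 i j
  rw [Matrix.mul_apply]
  have : (![aeval v f, aeval v g, aeval v b] : Fin 3 → _) i = aeval v (![f, g, b] i) := by
    fin_cases i <;> rfl
  simp only [Matrix.of_apply, jacobianMatrix, this, pderiv_aeval, AlgHom.mapMatrix_apply,
    Matrix.map_apply]

theorem jacobianDerivation_self_left (f g : MvPolynomial (Fin 3) k) :
    jacobianDerivation f g f = 0 := by
  simp [jacobianDerivation]; ring

theorem jacobianDerivation_self_right (f g : MvPolynomial (Fin 3) k) :
    jacobianDerivation f g g = 0 := by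
  simp [jacobianDerivation]; ring

theorem jacobianDerivation_swap (f g b : MvPolynomial (Fin 3) k) :
    jacobianDerivation f g b = -jacobianDerivation f b g := by
  simp [jacobianDerivation]; ring

theorem jacobianDerivation_coordinates (v : Fin 3 → MvPolynomial (Fin 3) k) :
    jacobianDerivation (v 0) (v 1) (v 2) = (jacobianMatrix v).det := by
  rw [jacobianDerivation_eq_det]
  congr 1
  ext1 i j
  fin_cases i <;> rfl

end Jacobian

theorem degD_eq_of_hasTop {k : Type*} [Field k] {n : ℕ}
    {D : Derivation k (MvPolynomial (Fin n) k) (MvPolynomial (Fin n) k)}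
    {b : MvPolynomial (Fin n) k} {i : ℕ} (h : HasTop D b i) : degD D b = (i : WithBot ℕ) := by
  have hset : {m : ℕ | (⇑D)^[m] b ≠ 0} = Set.Iic i := by
    ext m
    simp only [Set.mem_ofPred_eq, Set.mem_Iic]
    refine ⟨fun hm => ?_, fun hm h0 => h.1 (iterate_eq_zero_of_le h0 hm)⟩
    by_contra hlt
    exact hm (h.iterate_eq_zero (not_le.1 hlt))
  rw [degD, if_neg h.ne_zero, hset, csSup_Iic]

/-! ### Normal forms: degrees of X, Y, Z and failure of triangularizability. -/

section Normal

variable {k : Type*} [Field k] {r s : ℕ}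
  {D : Derivation k (MvPolynomial (Fin 3) k) (MvPolynomial (Fin 3) k)} {γ : k}
  {h : MvPolynomial (Fin 2) k} {c : ℕ → k} {X Y Z : MvPolynomial (Fin 3) k}

theorem IsNormalForm.left_ne_zero (H : IsNormalForm r s D γ h c X Y Z) : X ≠ 0 := by
  intro h0
  have h1 : aeval ![X, Y, Z] (MvPolynomial.X 0 : MvPolynomial (Fin 3) k) =
      aeval ![X, Y, Z] (0 : MvPolynomial (Fin 3) k) := by
    rw [aeval_X, map_zero]; exact h0
  exact X_ne_zero _ (H.linear.1.1 h1)

theorem IsNormalForm.apply_left (H : IsNormalForm r s D γ h c X Y Z) : D X = 0 := by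
  rw [H.eq_smul, Derivation.smul_apply, jacobianDerivation_self_left, smul_zero]

theorem IsNormalForm.apply_normalP (H : IsNormalForm r s D γ h c X Y Z) :
    D (normalP r s h c X Y Z) = 0 := by
  rw [H.eq_smul, Derivation.smul_apply, jacobianDerivation_self_right, smul_zero]

/-- X and Z̃ are both killed by the Jacobian derivation of X and Z̃, so only the last term of P
contributes, through Y. Antisymmetry exchanges the roles of Z̃ and P. -/
theorem IsNormalForm.apply_tildeZ (H : IsNormalForm r s D γ h c X Y Z) :
    ∃ a : k, a ≠ 0 ∧ D (tildeZ s h X Y Z) = C a * X ^ (r * s - 1 + (s - 1)) := by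
  obtain ⟨κ, hκ, hdet⟩ := H.linear.det_eq
  have hZ : jacobianDerivation X Y Z = C κ := hdet ▸ jacobianDerivation_coordinates ![X, Y, Z]
  refine ⟨γ * (c r * κ), mul_ne_zero H.unit_ne_zero (mul_ne_zero H.last_ne_zero hκ), ?_⟩
  set T := tildeZ s h X Y Z with hT
  have hYT : jacobianDerivation X Y T = X ^ (s - 1) * C κ := by
    rw [hT, tildeZ, map_add, derivation_aeval, Derivation.leibniz, Derivation.leibniz_pow, hZ]
    simp [Fin.sum_univ_two, jacobianDerivation_self_left, jacobianDerivation_self_right]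
  have hP : jacobianDerivation X T (normalP r s h c X Y Z) =
      -(C (c r) * X ^ (r * s - 1) * (X ^ (s - 1) * C κ)) := by
    have hY : jacobianDerivation X T Y = -(X ^ (s - 1) * C κ) := by
      rw [jacobianDerivation_swap, hYT]
    rw [normalP, ← hT]
    simp [Derivation.leibniz, Derivation.leibniz_pow, jacobianDerivation_self_left,
      jacobianDerivation_self_right, hY]
  rw [H.eq_smul, Derivation.smul_apply, jacobianDerivation_swap, hP, neg_neg, smul_eq_C_mul]
  simp only [C_mul, pow_add]
  ring

/-- Z̃ has degree 1. The relation P(X, Y, Z̃) ∈ ker D then determines the degree of Y, and the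
definition of Z̃ that of Z. -/
theorem IsNormalForm.hasTop [CharZero k] (hr : 2 ≤ r) (hs : 2 ≤ s) (hD : IsLocallyNilpotent D)
    (H : IsNormalForm r s D γ h c X Y Z) :
    HasTop D X 0 ∧ HasTop D Y r ∧ HasTop D Z (r * s) := by
  have hX0 : X ≠ 0 := H.left_ne_zero
  have hX : HasTop D X 0 := hasTop_zero_iff.2 ⟨hX0, H.apply_left⟩
  have hC : ∀ {a : k}, a ≠ 0 → HasTop D (C a) 0 := fun {a} ha =>
    hasTop_zero_iff.2 ⟨by simpa using ha, by simp⟩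
  have hCX : ∀ {a : k} (i : ℕ), a ≠ 0 → HasTop D (C a * X ^ i) 0 := fun {a} i ha => by
    simpa using (hC ha).mul (hX.pow i)
  obtain ⟨a, ha, hDT⟩ := H.apply_tildeZ
  set T := tildeZ s h X Y Z with hT
  have hT1 : HasTop D T 1 := HasTop.of_succ (by rw [hDT]; exact hCX _ ha)
  have hYne : Y ≠ 0 := by
    intro h0
    have h1 : aeval ![X, Y, Z] (MvPolynomial.X 1 : MvPolynomial (Fin 3) k) =
        aeval ![X, Y, Z] (0 : MvPolynomial (Fin 3) k) := by
      rw [aeval_X, map_zero]; exact h0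
    exact X_ne_zero _ (H.linear.1.1 h1)
  have hZne : Z ≠ 0 := by
    intro h0
    have h1 : aeval ![X, Y, Z] (MvPolynomial.X 2 : MvPolynomial (Fin 3) k) =
        aeval ![X, Y, Z] (0 : MvPolynomial (Fin 3) k) := by
      rw [aeval_X, map_zero]; exact h0
    exact X_ne_zero _ (H.linear.1.1 h1)
  -- Solve P for its last term: Z̃^r has degree r, the remaining powers of Z̃ have smaller degree,
  -- and P has degree 0.
  have hY : HasTop D Y r := by
    have hTr : HasTop D (T ^ r) r := by simpa using hT1.pow r
    have hlow : (⇑D)^[r] (∑ i ∈ Finset.Icc 1 (r - 1), C (c i) * X ^ (i * s) * T ^ (r - i) -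
        normalP r s h c X Y Z) = 0 := by
      rw [iterate_sub_right, iterate_sum_right,
        iterate_eq_zero_of_le (i := 1) (b := normalP r s h c X Y Z) H.apply_normalP (by omega),
        sub_zero]
      refine Finset.sum_eq_zero fun i hi => ?_
      rw [Finset.mem_Icc] at hi
      by_cases hci : c i = 0
      · simp [hci]
      · have := (hCX (i * s) hci).mul (hT1.pow (r - i))
        exact this.iterate_eq_zero (by omega)
    have h1 := hTr.add_of_iterate_eq_zero hlow
    have h2 : T ^ r + (∑ i ∈ Finset.Icc 1 (r - 1), C (c i) * X ^ (i * s) * T ^ (r - i) -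
        normalP r s h c X Y Z) = C (-c r) * X ^ (r * s - 1) * Y := by
      rw [normalP, ← hT]; simp only [C_neg]; ring
    rw [h2] at h1
    obtain ⟨j, hj⟩ := exists_hasTop hYne (hD Y)
    have h3 := (hCX (r * s - 1) (neg_ne_zero.2 H.last_ne_zero)).mul hj
    rw [zero_add] at h3
    rwa [h3.unique h1] at hj
  refine ⟨hX, hY, ?_⟩
  -- Likewise solve Z̃ = h + X^(s-1) Z for Z: since h is monic in Y, Y^s dominates the other
  -- monomials of h, and Z̃ has degree only 1.
  have hYs : HasTop D (Y ^ s) (r * s) := by rw [mul_comm]; exact hY.pow s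
  have hh : aeval ![X, Y] h = Y ^ s +
      ∑ m ∈ h.support.erase (Finsupp.single 1 s), C (h.coeff m) * (X ^ m 0 * Y ^ m 1) := by
    have hmem : Finsupp.single 1 s ∈ h.support := by
      rw [mem_support_iff, H.monic]; exact one_ne_zero
    rw [aeval_def, eval₂_eq']
    simp only [Fin.prod_univ_two]
    rw [← Finset.add_sum_erase _ _ hmem, H.monic]
    simp [algebraMap_eq]
  have hrs : 1 < r * s := by nlinarith
  have hlow : (⇑D)^[r * s] (∑ m ∈ h.support.erase (Finsupp.single 1 s),
      C (h.coeff m) * (X ^ m 0 * Y ^ m 1) - T) = 0 := by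
    rw [iterate_sub_right, iterate_sum_right, hT1.iterate_eq_zero hrs, sub_zero]
    refine Finset.sum_eq_zero fun m hm => ?_
    rw [Finset.mem_erase, mem_support_iff] at hm
    have := (hC hm.2).mul ((hX.pow (m 0)).mul (hY.pow (m 1)))
    refine this.iterate_eq_zero ?_
    have hdeg : m.degree = s := by
      by_contra hne
      exact hm.2 (H.homogeneous.coeff_eq_zero hne)
    rw [Finsupp.degree_eq_sum, Fin.sum_univ_two] at hdeg
    have hm0 : m 0 ≠ 0 := by
      intro h0
      refine hm.1 (Finsupp.ext fun i => ?_)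
      fin_cases i
      · simpa using h0
      · simp; omega
    have : m 1 < s := by omega
    have := Nat.mul_lt_mul_of_pos_right this (show 0 < r by omega)
    linarith
  have h1 := hYs.add_of_iterate_eq_zero hlow
  have h2 : Y ^ s + (∑ m ∈ h.support.erase (Finsupp.single 1 s),
      C (h.coeff m) * (X ^ m 0 * Y ^ m 1) - T) = C (-1) * X ^ (s - 1) * Z := by
    rw [← add_sub_assoc, ← hh, hT, tildeZ]; simp
  rw [h2] at h1
  obtain ⟨j, hj⟩ := exists_hasTop hZne (hD Z)
  have h3 := (hCX (s - 1) (neg_ne_zero.2 one_ne_zero)).mul hj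
  rw [zero_add] at h3
  rwa [h3.unique h1] at hj

theorem IsHomogeneousOfDegree.apply_homogeneousComponent {n : ℕ}
    {D : Derivation k (MvPolynomial (Fin n) k) (MvPolynomial (Fin n) k)} {d : ℕ}
    (hD : IsHomogeneousOfDegree D d) (m : ℕ) (b : MvPolynomial (Fin n) k) :
    D (homogeneousComponent m b) = homogeneousComponent (m + d) (D b) := by
  classical
  conv_rhs => rw [← sum_homogeneousComponent b, map_sum, map_sum]
  have : ∀ i, homogeneousComponent (m + d) (D (homogeneousComponent i b)) =
      if i = m then D (homogeneousComponent m b) else 0 := by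
    intro i
    rw [homogeneousComponent_of_mem (hD i _ (homogeneousComponent_isHomogeneous i b))]
    by_cases h : i = m
    · subst h; simp
    · rw [if_neg h, if_neg (by omega)]
  simp only [this, Finset.sum_ite_eq', Finset.mem_range]
  split_ifs with h
  · rfl
  · rw [homogeneousComponent_eq_zero _ _ (by omega), map_zero]

/-- For d > 0 every form in the image has positive degree. This rules out a nonzero constant D v₀ in
a triangular system. -/
theorem IsHomogeneousOfDegree.coeff_zero_apply {n : ℕ}
    {D : Derivation k (MvPolynomial (Fin n) k) (MvPolynomial (Fin n) k)} {d : ℕ} (hd : 0 < d)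
    (hD : IsHomogeneousOfDegree D d) (b : MvPolynomial (Fin n) k) : coeff 0 (D b) = 0 := by
  rw [← sum_homogeneousComponent b, map_sum, coeff_sum]
  refine Finset.sum_eq_zero fun i _ => ?_
  refine (hD i _ (homogeneousComponent_isHomogeneous i b)).coeff_eq_zero ?_
  simp; omega

/-- Linear forms killed by D² are multiples of X, because Y and Z have distinct degrees at least 2;
a triangular system would supply two independent ones. -/
theorem IsNormalForm.not_isTriangularizable [CharZero k] (hr : 2 ≤ r) (hs : 2 ≤ s)
    (hD : IsLocallyNilpotent D) {d : ℕ} (hd : 0 < d) (hhom : IsHomogeneousOfDegree D d) (H : IsNormalForm r s D γ h c X Y Z) :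
    ¬ IsTriangularizable D := by
  rintro ⟨v, hv, htri⟩
  obtain ⟨hX, hY, hZ⟩ := H.hasTop hr hs hD
  have hDv0 : D (v 0) = 0 := by
    have := htri 0
    simp only [Fin.not_lt_zero, Set.ofPred_false, Set.image_empty, Algebra.adjoin_empty,
      Algebra.mem_bot] at this
    obtain ⟨a, ha⟩ := this
    have hc := hhom.coeff_zero_apply hd (v 0)
    rw [← ha, algebraMap_eq, coeff_zero_C] at hc
    rw [← ha, hc, map_zero]
  have h0 : D (D (v 0)) = 0 := by rw [hDv0, map_zero]
  have h1 : D (D (v 1)) = 0 := by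
    have h2 : Set.EqOn D (0 : Derivation k _ _) (v '' {j | j < 1}) := by
      rintro _ ⟨j, hj, rfl⟩
      have : j = 0 := by
        fin_cases j
        · rfl
        · simp at hj
        · simp at hj
      rw [this, hDv0]; rfl
    exact Derivation.eqOn_adjoin h2 (htri 1)
  obtain ⟨M, N, hMN, hlin⟩ := hv.exists_linearPart
  -- Write the linear part in X, Y, Z. Applying D^(rs) isolates the coefficient of Z, and then D^r
  -- that of Y.
  have hkill : ∀ i, D (D (v i)) = 0 → ∃ a : k, linearForms M i = C a * X := by
    intro i hi
    have hDD : D (D (linearForms M i)) = 0 := by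
      rw [← hlin, hhom.apply_homogeneousComponent, hhom.apply_homogeneousComponent, hi, map_zero]
    obtain ⟨w, hw, hvw, hwv⟩ := H.linear.exists_inverse
    have hx : linearForms M i = ∑ j, C (coeff (Finsupp.single j 1) (aeval w (linearForms M i))) *
        ![X, Y, Z] j := by
      conv_lhs => rw [← hvw (linearForms M i), IsHomogeneous.eq_sum
        (aeval_isHomogeneous hw.2 (linearForms_isHomogeneous M i))]
      simp only [map_sum, map_mul, algHom_C, aeval_X, algebraMap_eq]
    rw [Fin.sum_univ_three] at hx
    generalize coeff (Finsupp.single 0 1) (aeval w (linearForms M i)) = a0 at hx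
    generalize coeff (Finsupp.single 1 1) (aeval w (linearForms M i)) = a1 at hx
    generalize coeff (Finsupp.single 2 1) (aeval w (linearForms M i)) = a2 at hx
    simp only [← smul_eq_C_mul, Matrix.cons_val_zero, Matrix.cons_val_one, Matrix.cons_val] at hx ⊢
    rw [hx] at hDD ⊢
    change (⇑D)^[2] _ = 0 at hDD
    have hrs : r < r * s := by nlinarith
    have e2 := iterate_eq_zero_of_le hDD (show 2 ≤ r * s by nlinarith)
    rw [iterate_add_right, iterate_add_right, iterate_smul_right, iterate_smul_right,
      iterate_smul_right, hX.iterate_eq_zero (by omega), hY.iterate_eq_zero hrs, smul_zero,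
      smul_zero, zero_add, zero_add, smul_eq_zero_iff_left hZ.1] at e2
    rw [e2, zero_smul, add_zero] at hDD ⊢
    have e1 := iterate_eq_zero_of_le hDD hr
    rw [iterate_add_right, iterate_smul_right, iterate_smul_right, hX.iterate_eq_zero (by omega),
      smul_zero, zero_add, smul_eq_zero_iff_left hY.1] at e1
    exact ⟨a0, by rw [e1, zero_smul, add_zero]⟩
  obtain ⟨a, ha⟩ := hkill 0 h0
  obtain ⟨b, hb⟩ := hkill 1 h1
  have hinj := (isLinearCoordinateSystem_linearForms hMN).1.1
  -- The two linear parts are a X and b X, which is a nontrivial relation between members of a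
  -- linear system of variables as soon as a ≠ 0.
  have hzero : C b * MvPolynomial.X 0 - C a * MvPolynomial.X 1 = (0 : MvPolynomial (Fin 3) k) := by
    apply hinj
    rw [map_sub, map_mul, map_mul, algHom_C, algHom_C, aeval_X, aeval_X, ha, hb, algebraMap_eq,
      map_zero]
    ring
  have hane : a ≠ 0 := by
    rintro rfl
    have : aeval (linearForms M) (MvPolynomial.X 0 : MvPolynomial (Fin 3) k) =
        aeval (linearForms M) (0 : MvPolynomial (Fin 3) k) := by
      rw [aeval_X, ha]; simp
    exact X_ne_zero _ (hinj this)
  have := congrArg (coeff (Finsupp.single 1 1)) hzero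
  rw [coeff_sub, coeff_C_mul, coeff_C_mul] at this
  simp [coeff_X, Finsupp.single_left_inj] at this
  exact hane this

end Normal

/-! ### Weighted leading parts of polynomials and derivations. -/

section Leading

variable {k : Type*} [Field k] {n : ℕ} (w : Fin n → ℤ)

/-- All monomials of `p` have `w`-weight at most `d`. -/
def WeightLE (d : ℤ) (p : MvPolynomial (Fin n) k) : Prop :=
  ∀ m, coeff m p ≠ 0 → Finsupp.weight w m ≤ d

variable {w}

theorem WeightLE.mono {d e : ℤ} {p : MvPolynomial (Fin n) k} (h : WeightLE w d p) (hde : d ≤ e) :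
    WeightLE w e p := fun m hm => (h m hm).trans hde

theorem weightLE_zero (d : ℤ) : WeightLE w d (0 : MvPolynomial (Fin n) k) := fun m hm => by
  simp at hm

theorem WeightLE.add {d : ℤ} {p q : MvPolynomial (Fin n) k} (hp : WeightLE w d p)
    (hq : WeightLE w d q) : WeightLE w d (p + q) := by
  intro m hm
  by_cases h : coeff m p = 0
  · exact hq m (by simpa [h] using hm)
  · exact hp m h

theorem WeightLE.sum {ι : Type*} (s : Finset ι) {d : ℤ} {f : ι → MvPolynomial (Fin n) k}
    (h : ∀ i ∈ s, WeightLE w d (f i)) : WeightLE w d (∑ i ∈ s, f i) :=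
  Finset.sum_induction _ (WeightLE w d) (fun _ _ => WeightLE.add) (weightLE_zero d) h

theorem _root_.MvPolynomial.IsWeightedHomogeneous.weightLE {d : ℤ} {p : MvPolynomial (Fin n) k}
    (hp : IsWeightedHomogeneous w p d) : WeightLE w d p := fun _ hm => (hp hm).le

theorem WeightLE.component_eq_zero {d e : ℤ} {p : MvPolynomial (Fin n) k} (hp : WeightLE w d p)
    (hde : d < e) : weightedHomogeneousComponent w e p = 0 := by
  refine weightedHomogeneousComponent_eq_zero' e p fun m hm => ?_
  exact ((hp m (mem_support_iff.1 hm)).trans_lt hde).ne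

theorem WeightLE.sub_component {d : ℤ} {p : MvPolynomial (Fin n) k} (hp : WeightLE w d p) :
    WeightLE w (d - 1) (p - weightedHomogeneousComponent w d p) := by
  classical
  intro m hm
  rw [coeff_sub, coeff_weightedHomogeneousComponent] at hm
  split_ifs at hm with h
  · simp at hm
  · have := lt_of_le_of_ne (hp m (by simpa using hm)) h
    omega

theorem WeightLE.monomial_mul {e : ℤ} {q : MvPolynomial (Fin n) k} (hq : WeightLE w e q)
    (m : Fin n →₀ ℕ) (a : k) : WeightLE w (Finsupp.weight w m + e) (monomial m a * q) := by
  classical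
  intro x hx
  rw [coeff_monomial_mul'] at hx
  split_ifs at hx with h
  · obtain ⟨y, rfl⟩ := exists_add_of_le h
    rw [add_tsub_cancel_left] at hx
    rw [map_add]
    have := hq y (right_ne_zero_of_mul hx)
    omega
  · exact absurd rfl hx

theorem component_monomial_mul (e : ℤ) (q : MvPolynomial (Fin n) k) (m : Fin n →₀ ℕ) (a : k) :
    weightedHomogeneousComponent w (Finsupp.weight w m + e) (monomial m a * q) =
      monomial m a * weightedHomogeneousComponent w e q := by
  classical
  ext x
  rw [coeff_weightedHomogeneousComponent, coeff_monomial_mul', coeff_monomial_mul']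
  by_cases h : m ≤ x
  · obtain ⟨y, rfl⟩ := exists_add_of_le h
    rw [if_pos h, if_pos h, add_tsub_cancel_left, coeff_weightedHomogeneousComponent, map_add]
    simp
  · simp [h]

variable (w) in
/-- The part of `δ` raising the `w`-weight by exactly `e`. -/
noncomputable def leadingDerivation
    (δ : Derivation k (MvPolynomial (Fin n) k) (MvPolynomial (Fin n) k)) (e : ℤ) :
    Derivation k (MvPolynomial (Fin n) k) (MvPolynomial (Fin n) k) :=
  mkDerivation k fun i => weightedHomogeneousComponent w (w i + e) (δ (X i))

variable {δ : Derivation k (MvPolynomial (Fin n) k) (MvPolynomial (Fin n) k)} {e : ℤ}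

theorem derivation_monomial (m : Fin n →₀ ℕ) (a : k) :
    δ (monomial m a) = ∑ i ∈ m.support, monomial (m - Finsupp.single i 1) (a * m i) * δ (X i) := by
  have hδ : δ = mkDerivation k fun i => δ (X i) := derivation_ext fun i => by rw [mkDerivation_X]
  conv_lhs => rw [hδ, mkDerivation_monomial, Finsupp.sum, Finset.smul_sum]
  refine Finset.sum_congr rfl fun i _ => ?_
  rw [smul_eq_mul, ← smul_mul_assoc, smul_monomial, smul_eq_mul]

theorem weight_sub_single {m : Fin n →₀ ℕ} {i : Fin n} (hi : i ∈ m.support) :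
    Finsupp.weight w m = Finsupp.weight w (m - Finsupp.single i 1) + w i := by
  have h : m - Finsupp.single i 1 + Finsupp.single i 1 = m :=
    tsub_add_cancel_of_le (Finsupp.single_le_iff.2 (Nat.one_le_iff_ne_zero.2
      (Finsupp.mem_support_iff.1 hi)))
  conv_lhs => rw [← h, map_add, Finsupp.weight_single, one_smul]

/-- In each Leibniz summand one factor `X i`, of weight `w i`, is replaced by δ (X i), whose weight
is at most `w i + e`. -/
theorem leading_monomial (he : ∀ i, WeightLE w (w i + e) (δ (X i))) (m : Fin n →₀ ℕ) (a : k) :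
    WeightLE w (Finsupp.weight w m + e) (δ (monomial m a)) ∧
      weightedHomogeneousComponent w (Finsupp.weight w m + e) (δ (monomial m a)) =
        leadingDerivation w δ e (monomial m a) := by
  rw [derivation_monomial, derivation_monomial, map_sum]
  refine ⟨WeightLE.sum _ fun i hi => ?_, Finset.sum_congr rfl fun i hi => ?_⟩
  · rw [weight_sub_single hi, add_assoc]
    exact (he i).monomial_mul _ _
  · rw [weight_sub_single hi, add_assoc, component_monomial_mul, leadingDerivation, mkDerivation_X]

theorem leading_apply (he : ∀ i, WeightLE w (w i + e) (δ (X i))) {d : ℤ}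
    {p : MvPolynomial (Fin n) k} (hp : WeightLE w d p) :
    WeightLE w (d + e) (δ p) ∧ weightedHomogeneousComponent w (d + e) (δ p) =
        leadingDerivation w δ e (weightedHomogeneousComponent w d p) := by
  classical
  have hle : ∀ m ∈ p.support, Finsupp.weight w m ≤ d := fun m hm => hp m (mem_support_iff.1 hm)
  rw [p.as_sum]
  simp only [map_sum]
  refine ⟨WeightLE.sum _ fun m hm => (leading_monomial he m _).1.mono (by linarith [hle m hm]),
    Finset.sum_congr rfl fun m hm => ?_⟩
  rcases (hle m hm).eq_or_lt with h | h
  · rw [← h, (leading_monomial he m _).2,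
      weightedHomogeneousComponent_of_mem (n := Finsupp.weight w m)
      (isWeightedHomogeneous_monomial w m _ rfl), if_pos rfl]
  · rw [(leading_monomial he m _).1.component_eq_zero (by linarith),
      (isWeightedHomogeneous_monomial w m _ rfl).weightLE.component_eq_zero h, map_zero]

theorem leading_iterate (he : ∀ i, WeightLE w (w i + e) (δ (X i))) {d : ℤ}
    {p : MvPolynomial (Fin n) k} (hp : WeightLE w d p) (N : ℕ) :
    WeightLE w (d + N * e) ((⇑δ)^[N] p) ∧ weightedHomogeneousComponent w (d + N * e) ((⇑δ)^[N] p) =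
        (⇑(leadingDerivation w δ e))^[N] (weightedHomogeneousComponent w d p) := by
  induction N with
  | zero => simpa using hp
  | succ N ih =>
    rw [Function.iterate_succ_apply', Function.iterate_succ_apply']
    have := leading_apply he ih.1
    rw [ih.2] at this
    have heq : d + ((N + 1 : ℕ) : ℤ) * e = d + N * e + e := by push_cast; ring
    rwa [heq]

/-- On a monomial, each iterate of the leading derivation is a weighted component of the same
iterate of δ, so it vanishes once the latter does. -/
theorem leadingDerivation_locallyNilpotent (hδ : IsLocallyNilpotent δ)
    (he : ∀ i, WeightLE w (w i + e) (δ (X i))) : IsLocallyNilpotent (leadingDerivation w δ e) := by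
  classical
  intro p
  induction p using MvPolynomial.induction_on' with
  | monomial m a =>
    obtain ⟨N, hN⟩ := hδ (monomial m a)
    have hm := isWeightedHomogeneous_monomial w m a rfl
    have := (leading_iterate he hm.weightLE N).2
    rw [hN, map_zero, weightedHomogeneousComponent_of_mem hm, if_pos rfl] at this
    exact ⟨N, this.symm⟩
  | add p q hp hq =>
    obtain ⟨M, hM⟩ := hp
    obtain ⟨N, hN⟩ := hq
    refine ⟨max M N, ?_⟩
    rw [iterate_add_right, iterate_eq_zero_of_le hM (le_max_left _ _),
      iterate_eq_zero_of_le hN (le_max_right _ _), add_zero]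

variable (w) in
/-- Passing to leading parts for the weights `w` turns a nonzero locally nilpotent derivation into
another one, and its kernel elements into kernel elements. -/
theorem exists_leading_derivation (hδ : IsLocallyNilpotent δ) (hδ0 : δ ≠ 0) :
    ∃ δ' : Derivation k (MvPolynomial (Fin n) k) (MvPolynomial (Fin n) k),
      IsLocallyNilpotent δ' ∧ δ' ≠ 0 ∧ ∀ (d : ℤ) (p : MvPolynomial (Fin n) k), WeightLE w d p →
        δ p = 0 → δ' (weightedHomogeneousComponent w d p) = 0 := by
  classical
  let S : Finset (Σ _ : Fin n, (Fin n →₀ ℕ)) := Finset.univ.sigma fun i => (δ (X i)).support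
  have hS : S.Nonempty := by
    by_contra hne
    rw [Finset.not_nonempty_iff_eq_empty] at hne
    refine hδ0 (derivation_ext fun i => ?_)
    rw [Derivation.zero_apply, ← support_eq_empty]
    by_contra h
    obtain ⟨m, hm⟩ := Finset.nonempty_iff_ne_empty.2 h
    have : (⟨i, m⟩ : Σ _ : Fin n, (Fin n →₀ ℕ)) ∈ S := by simpa [S] using hm
    simp [hne] at this
  -- Take for e the largest weight increase among all monomials of all δ (X i); since it is
  -- attained, the leading derivation is nonzero.
  obtain ⟨⟨i, m⟩, him, hmax⟩ := S.exists_max_image (fun x => Finsupp.weight w x.2 - w x.1) hS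
  set e := Finsupp.weight w m - w i with he_def
  have he : ∀ i, WeightLE w (w i + e) (δ (X i)) := by
    intro j m' hm'
    have := hmax ⟨j, m'⟩ (by simpa [S] using hm')
    simp only at this
    linarith
  refine ⟨leadingDerivation w δ e, leadingDerivation_locallyNilpotent hδ he, fun h0 => ?_,
    fun d p hp hp0 => ?_⟩
  · have h1 := congrArg (fun d => coeff m (d (X i))) h0
    simp only [leadingDerivation, mkDerivation_X, coeff_weightedHomogeneousComponent,
      Derivation.zero_apply, coeff_zero] at h1
    rw [if_pos (by rw [he_def]; ring)] at h1
    have : coeff m (δ (X i)) ≠ 0 := by simpa [S] using him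
    exact this h1
  · rw [← (leading_apply he hp).2, hp0, map_zero]

end Leading

/-! ### Kernel elements in two variables: extreme monomials. -/

section Plane

variable {k : Type*} [Field k]

theorem X_dvd_of_forall {n : ℕ} {i : Fin n} {p : MvPolynomial (Fin n) k}
    (h : ∀ m, coeff m p ≠ 0 → m i ≠ 0) : X i ∣ p := by
  rw [p.as_sum]
  exact Finset.dvd_sum fun m hm => X_dvd_monomial.2 (Or.inr (h m (mem_support_iff.1 hm)))

theorem weight_plane {i j : Fin 2} (hij : i ≠ j) (w : Fin 2 → ℤ) (m : Fin 2 →₀ ℕ) :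
    Finsupp.weight w m = m i * w i + m j * w j := by
  rw [Finsupp.weight_apply, Finsupp.sum_fintype _ _ (by simp), Fin.sum_univ_two]
  fin_cases i <;> fin_cases j <;> simp at hij ⊢
  ring

theorem exists_coeff_ne_zero_eq_degreeOf {n : ℕ} {p : MvPolynomial (Fin n) k} (hp : p ≠ 0)
    (i : Fin n) : ∃ m, coeff m p ≠ 0 ∧ m i = degreeOf i p := by
  obtain ⟨m, hm, h⟩ := Finset.exists_mem_eq_sup p.support (support_nonempty.2 hp) fun m => m i
  exact ⟨m, mem_support_iff.1 hm, by rw [degreeOf_eq_sup, h]⟩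

theorem le_degreeOf {n : ℕ} {p : MvPolynomial (Fin n) k} {m : Fin n →₀ ℕ} (hm : coeff m p ≠ 0)
    (i : Fin n) : m i ≤ degreeOf i p :=
  monomial_le_degreeOf i (mem_support_iff.2 hm)

theorem eq_zero_of_apply_X {i j : Fin 2} (hij : i ≠ j)
    {δ : Derivation k (MvPolynomial (Fin 2) k) (MvPolynomial (Fin 2) k)}
    (hi : δ (X i) = 0) (hj : δ (X j) = 0) : δ = 0 := by
  refine derivation_ext fun l => ?_
  rw [Derivation.zero_apply]
  fin_cases i <;> fin_cases j <;> fin_cases l <;> simp_all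

variable [CharZero k] {δ : Derivation k (MvPolynomial (Fin 2) k) (MvPolynomial (Fin 2) k)}
  {F : MvPolynomial (Fin 2) k}

/-- The leading monomial in each direction is a pure power. -/
theorem eq_zero_of_eq_degreeOf (hδ : IsLocallyNilpotent δ) (hδ0 : δ ≠ 0) (hF : δ F = 0)
    {i j : Fin 2} (hij : i ≠ j) (hi : degreeOf i F ≠ 0) {m : Fin 2 →₀ ℕ} (hm : coeff m F ≠ 0)
    (hmi : m i = degreeOf i F) : m j = 0 := by
  classical
  obtain ⟨μ, hμ, hmax⟩ := (F.support.filter fun μ => μ i = degreeOf i F).exists_max_image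
    (fun μ => μ j) ⟨m, by simp [hm, hmi]⟩
  simp only [Finset.mem_filter, mem_support_iff] at hμ hmax
  refine Nat.le_zero.1 ((hmax m ⟨hm, hmi⟩).trans (Nat.le_zero.2 ?_))
  by_contra hμj
  -- These weights order the monomials of F first by the exponent of `X i`, then by that of `X j`,
  -- so that the leading part is the single monomial μ.
  let w : Fin 2 → ℤ := fun l => if l = i then degreeOf j F + 1 else 1
  have hw : ∀ ν : Fin 2 →₀ ℕ, Finsupp.weight w ν = ν i * ((degreeOf j F : ℤ) + 1) + ν j := by
    intro ν
    rw [weight_plane hij]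
    simp [w, hij.symm]
  have hlt : ∀ ν, coeff ν F ≠ 0 → ν i < degreeOf i F →
      Finsupp.weight w ν < Finsupp.weight w μ := by
    intro ν hν h
    rw [hw, hw]
    have h2 : (ν j : ℤ) ≤ degreeOf j F := by exact_mod_cast le_degreeOf hν j
    have h3 : (ν i : ℤ) + 1 ≤ μ i := by rw [hμ.2]; exact_mod_cast h
    nlinarith
  have hle : WeightLE w (Finsupp.weight w μ) F := by
    intro ν hν
    rcases (le_degreeOf hν i).lt_or_eq with h | h
    · exact (hlt ν hν h).le
    · have := hmax ν ⟨hν, h⟩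
      rw [hw, hw, h, hμ.2]
      have : (ν j : ℤ) ≤ μ j := by exact_mod_cast this
      linarith
  obtain ⟨δ', hδ', hδ'0, hker⟩ := exists_leading_derivation w hδ hδ0
  have h0 := hker _ F hle hF
  set G := weightedHomogeneousComponent w (Finsupp.weight w μ) F with hG
  have hcoeff : ∀ ν, coeff ν G ≠ 0 → ν i = μ i ∧ ν j = μ j := by
    intro ν hν
    rw [hG, coeff_weightedHomogeneousComponent] at hν
    split_ifs at hν with h
    · have hνi : ν i = degreeOf i F := by
        by_contra hne
        exact (hlt ν hν (lt_of_le_of_ne (le_degreeOf hν i) hne)).ne h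
      rw [hw, hw, hνi, hμ.2] at h
      exact ⟨hνi.trans hμ.2.symm, by exact_mod_cast add_left_cancel h⟩
    · exact absurd rfl hν
  have hG0 : G ≠ 0 := by
    intro h
    have := congrArg (coeff μ) h
    rw [hG, coeff_weightedHomogeneousComponent, if_pos rfl] at this
    exact hμ.1 (by simpa using this)
  -- A killed monomial involving both variables would, by factorial closedness, force both variables
  -- to be killed.
  refine hδ'0 (eq_zero_of_apply_X hij ?_ ?_)
  · exact apply_eq_zero_of_dvd hδ' hG0 h0 (X_dvd_of_forall fun ν hν => by
      rw [(hcoeff ν hν).1, hμ.2]; exact hi)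
  · exact apply_eq_zero_of_dvd hδ' hG0 h0 (X_dvd_of_forall fun ν hν => by
      rw [(hcoeff ν hν).2]; exact hμj)

theorem coeff_single_degreeOf_ne_zero (hδ : IsLocallyNilpotent δ) (hδ0 : δ ≠ 0) (hF : δ F = 0)
    {i j : Fin 2} (hij : i ≠ j) (hi : degreeOf i F ≠ 0) :
    coeff (Finsupp.single i (degreeOf i F)) F ≠ 0 := by
  obtain ⟨m, hm, hmi⟩ := exists_coeff_ne_zero_eq_degreeOf (ne_zero_of_degreeOf_ne_zero hi) i
  have hmj := eq_zero_of_eq_degreeOf hδ hδ0 hF hij hi hm hmi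
  have : m = Finsupp.single i (degreeOf i F) := by
    ext l
    fin_cases i <;> fin_cases j <;> fin_cases l <;> simp_all
  rwa [this] at hm

/-- A two-term weighted form killed by a nonzero locally nilpotent derivation is linear in one of
the variables. -/
theorem eq_one_or_eq_one_of_apply_eq_zero (hδ : IsLocallyNilpotent δ) (hδ0 : δ ≠ 0) {a b : ℕ}
    (ha : a ≠ 0) (hb : b ≠ 0) {c : k} (hc : c ≠ 0)
    (h : δ (X 0 ^ b - C c * X 1 ^ a) = 0) : a = 1 ∨ b = 1 := by
  by_contra! hne
  obtain ⟨a, rfl⟩ : ∃ a', a = a' + 2 := ⟨a - 2, by omega⟩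
  obtain ⟨b, rfl⟩ : ∃ b', b = b' + 2 := ⟨b - 2, by omega⟩
  have hX : ∀ i j : Fin 2, i ≠ j → ∀ (e : k) (m : ℕ) (p : MvPolynomial (Fin 2) k), e ≠ 0 →
      (X i : MvPolynomial (Fin 2) k) ∣ C e * X j ^ m * p → X i ∣ p := by
    intro i j hij e m p he hd
    rcases X_prime.dvd_or_dvd hd with hd | hd
    · rcases X_prime.dvd_or_dvd hd with hd | hd
      · rw [← mul_one (C e), ← smul_eq_C_mul] at hd
        have : IsUnit (C e : MvPolynomial (Fin 2) k) := (isUnit_iff_ne_zero.2 he).map C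
        rw [smul_eq_C_mul, mul_one] at hd
        exact absurd (isUnit_of_dvd_unit hd this) X_prime.not_isUnit
      · have := X_prime.dvd_of_dvd_pow hd
        rw [X_dvd_X] at this
        exact absurd this hij
    · exact hd
  -- With both exponents at least 2 each side keeps a factor of its own variable. Hence X 1 divides
  -- δ (X 0) and X 0 divides δ (X 1), and the degree argument applies.
  have key : C ((b + 2 : ℕ) : k) * X 0 ^ (b + 1) * δ (X 0) =
      C (c * ((a + 2 : ℕ) : k)) * X 1 ^ (a + 1) * δ (X 1) := by
    rw [Derivation.map_sub, sub_eq_zero, Derivation.leibniz, Derivation.leibniz_pow,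
      Derivation.leibniz_pow] at h
    simp only [derivation_C, smul_eq_mul, nsmul_eq_mul,
      show b + 2 - 1 = b + 1 from rfl, show a + 2 - 1 = a + 1 from rfl] at h
    rw [C_mul, C_eq_coe_nat, C_eq_coe_nat, mul_assoc, h]
    ring
  have hb' : ((b + 2 : ℕ) : k) ≠ 0 := Nat.cast_ne_zero.2 (by omega)
  have ha' : c * ((a + 2 : ℕ) : k) ≠ 0 := mul_ne_zero hc (Nat.cast_ne_zero.2 (by omega))
  have h1 : X 1 ∣ δ (X 0) := by
    refine hX 1 0 (by decide) _ (b + 1) _ hb' ?_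
    rw [key, pow_succ]
    exact ⟨C (c * ((a + 2 : ℕ) : k)) * X 1 ^ a * δ (X 1), by ring⟩
  have h2 : X 0 ∣ δ (X 1) := by
    refine hX 0 1 (by decide) _ (a + 1) _ ha' ?_
    rw [← key, pow_succ]
    exact ⟨C ((b + 2 : ℕ) : k) * X 0 ^ b * δ (X 0), by ring⟩
  have hne0 : ∀ (i : Fin 2) (m : ℕ), (X i : MvPolynomial (Fin 2) k) ^ m ≠ 0 :=
    fun i m => pow_ne_zero _ (X_ne_zero i)
  refine hδ0 ?_
  rcases apply_eq_zero_of_cross_dvd hδ h1 h2 with h0 | h0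
  · rw [h0, mul_zero] at key
    refine eq_zero_of_apply_X (i := 0) (j := 1) (by decide) h0 ?_
    exact (mul_eq_zero.1 key.symm).resolve_left (mul_ne_zero (C_ne_zero.2 ha') (hne0 _ _))
  · rw [h0, mul_zero] at key
    refine eq_zero_of_apply_X (i := 0) (j := 1) (by decide) ?_ h0
    exact (mul_eq_zero.1 key).resolve_left (mul_ne_zero (C_ne_zero.2 hb') (hne0 _ _))

end Plane

/-! ### The leading form along the edge of the Newton polygon. -/

section LeadingForm

variable {k : Type*} [Field k]

theorem C_mul_pow_mul_pow (u : k) (a b i j : ℕ) :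
    C u * (X 0 ^ b) ^ i * (X 1 ^ a) ^ j =
      (monomial (Finsupp.single 0 (b * i) + Finsupp.single 1 (a * j)) u :
        MvPolynomial (Fin 2) k) := by
  rw [← pow_mul, ← pow_mul, X_pow_eq_monomial, X_pow_eq_monomial, C_mul_monomial, monomial_mul]
  simp

theorem weight_fin_two (x y : ℤ) (m : Fin 2 →₀ ℕ) :
    Finsupp.weight ![x, y] m = m 0 * x + m 1 * y := by
  rw [weight_plane (i := 0) (j := 1) (by decide)]
  rfl

variable [CharZero k] [IsAlgClosed k]
  {δ : Derivation k (MvPolynomial (Fin 2) k) (MvPolynomial (Fin 2) k)}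
  {F : MvPolynomial (Fin 2) k}

/-- The Newton polygon of a kernel element is a triangle, and the leading form along its edge is a
power of a form that is linear in one of the variables. -/
theorem exists_leading_form (hδ : IsLocallyNilpotent δ) (hδ0 : δ ≠ 0) (hF : δ F = 0)
    (h0 : degreeOf 0 F ≠ 0) (h1 : degreeOf 1 F ≠ 0) :
    ∃ (a b g : ℕ) (c l : k), c ≠ 0 ∧ l ≠ 0 ∧ degreeOf 0 F = g * b ∧ degreeOf 1 F = g * a ∧
      (a = 1 ∨ b = 1) ∧ WeightLE ![(a : ℤ), (b : ℤ)] (a * b * g) F ∧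
      weightedHomogeneousComponent ![(a : ℤ), (b : ℤ)] (a * b * g) F =
        C c * (X 0 ^ b - C l * X 1 ^ a) ^ g := by
  classical
  -- The edge joins X₀^(bg) and X₁^(ag) with a, b coprime; for the weights (a, b) both endpoints
  -- have weight abg.
  obtain ⟨g, b, a, hg, hcop, hm, hr⟩ := Nat.exists_coprime' (Nat.gcd_pos_of_pos_left
    (degreeOf 1 F) (Nat.pos_of_ne_zero h0))
  have hb : b ≠ 0 := by rintro rfl; simp at hm; exact h0 hm
  have ha : a ≠ 0 := by rintro rfl; simp at hr; exact h1 hr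
  set w : Fin 2 → ℤ := ![(a : ℤ), (b : ℤ)] with hw
  have hwt : ∀ ν : Fin 2 →₀ ℕ, Finsupp.weight w ν = ν 0 * a + ν 1 * b := weight_fin_two _ _
  have hF0 : F ≠ 0 := ne_zero_of_degreeOf_ne_zero h0
  obtain ⟨δ', hδ', hδ'0, hker⟩ := exists_leading_derivation w hδ hδ0
  -- A monomial of F of weight above abg must involve both variables, since its exponents are at
  -- most bg and ag. A leading form made of such monomials would be divisible by both variables,
  -- killing both.
  have htop : WeightLE w (a * b * g) F := by
    obtain ⟨μ, hμ, hmax⟩ := F.support.exists_max_image (fun μ => Finsupp.weight w μ)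
      (support_nonempty.2 hF0)
    have hle : WeightLE w (Finsupp.weight w μ) F := fun ν hν => hmax ν (mem_support_iff.2 hν)
    refine hle.mono ?_
    by_contra! hlt
    have hk := hker _ F hle hF
    set G := weightedHomogeneousComponent w (Finsupp.weight w μ) F with hG
    have hcoeff : ∀ ν, coeff ν G ≠ 0 → ν 0 ≠ 0 ∧ ν 1 ≠ 0 := by
      intro ν hν
      rw [hG, coeff_weightedHomogeneousComponent] at hν
      split_ifs at hν with h
      · have e0 : (ν 0 : ℤ) ≤ b * g := by exact_mod_cast hm ▸ le_degreeOf hν 0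
        have e1 : (ν 1 : ℤ) ≤ a * g := by exact_mod_cast hr ▸ le_degreeOf hν 1
        rw [← h, hwt] at hlt
        constructor
        · intro hz; rw [hz] at hlt; push_cast at hlt; nlinarith
        · intro hz; rw [hz] at hlt; push_cast at hlt; nlinarith
      · exact absurd rfl hν
    have hG0 : G ≠ 0 := by
      intro h
      have := congrArg (coeff μ) h
      rw [hG, coeff_weightedHomogeneousComponent, if_pos rfl] at this
      exact mem_support_iff.1 hμ (by simpa using this)
    exact hδ'0 (eq_zero_of_apply_X (i := 0) (j := 1) (by decide)
      (apply_eq_zero_of_dvd hδ' hG0 hk (X_dvd_of_forall fun ν hν => (hcoeff ν hν).1))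
      (apply_eq_zero_of_dvd hδ' hG0 hk (X_dvd_of_forall fun ν hν => (hcoeff ν hν).2)))
  have hk := hker _ F htop hF
  set G := weightedHomogeneousComponent w (a * b * g) F with hG
  let E : ℕ → (Fin 2 →₀ ℕ) := fun i => Finsupp.single 0 (b * i) + Finsupp.single 1 (a * (g - i))
  have hE0 : ∀ i, E i 0 = b * i := fun i => by simp [E]
  have hE1 : ∀ i, E i 1 = a * (g - i) := fun i => by simp [E]
  let u : ℕ → k := fun i => coeff (E i) F
  have hug : u g ≠ 0 := by
    have := coeff_single_degreeOf_ne_zero hδ hδ0 hF (i := 0) (j := 1) (by decide) h0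
    simpa [u, E, hm] using this
  have hu0 : u 0 ≠ 0 := by
    have := coeff_single_degreeOf_ne_zero hδ hδ0 hF (i := 1) (j := 0) (by decide) h1
    simpa [u, E, hr] using this
  set S : MvPolynomial (Fin 2) k := X 0 ^ b with hS
  set T : MvPolynomial (Fin 2) k := X 1 ^ a with hT
  -- Coprimality makes the lattice points on the edge exactly the exponents (b i, a (g - i)).
  have hGsum : G = ∑ i ∈ Finset.range (g + 1), C (u i) * S ^ i * T ^ (g - i) := by
    ext ν
    rw [coeff_sum, hG, coeff_weightedHomogeneousComponent]
    simp only [hS, hT, C_mul_pow_mul_pow, coeff_monomial]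
    change _ = ∑ i ∈ Finset.range (g + 1), if E i = ν then u i else 0
    split_ifs with h
    · rw [hwt] at h
      have h' : ν 0 * a + ν 1 * b = a * b * g := by exact_mod_cast h
      obtain ⟨i, hi⟩ : b ∣ ν 0 := by
        refine hcop.dvd_of_dvd_mul_right ?_
        rw [← Nat.dvd_add_left (Dvd.intro_left (ν 1) rfl), h']
        exact ⟨a * g, by ring⟩
      have h2 : i * a + ν 1 = a * g := by
        refine Nat.eq_of_mul_eq_mul_left (Nat.pos_of_ne_zero hb) ?_
        rw [hi] at h'
        linarith
      have hig : i ≤ g := by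
        refine Nat.le_of_mul_le_mul_left (?_ : a * i ≤ a * g) (Nat.pos_of_ne_zero ha)
        rw [mul_comm a i]; omega
      have hEi : E i = ν := by
        ext l
        fin_cases l
        · exact (hE0 i).trans hi.symm
        · refine (hE1 i).trans ?_
          change _ = ν 1
          rw [Nat.mul_sub, mul_comm a i]; omega
      rw [Finset.sum_eq_single i, if_pos hEi, ← hEi]
      · intro j _ hj
        rw [if_neg]
        intro hEj
        refine hj (Nat.eq_of_mul_eq_mul_left (Nat.pos_of_ne_zero hb) ?_)
        rw [← hE0, ← hE0, hEj, hEi]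
      · intro hn
        exact absurd (Finset.mem_range.2 (by omega)) hn
    · refine (Finset.sum_eq_zero fun i hi => if_neg ?_).symm
      rintro rfl
      refine h ?_
      rw [hwt, hE0, hE1, Nat.cast_mul, Nat.cast_mul, Nat.cast_sub (by simp at hi; omega)]
      ring
  have hG0 : G ≠ 0 := by
    intro h
    have := congrArg (coeff (E g)) h
    rw [hG, coeff_weightedHomogeneousComponent, if_pos] at this
    · exact hug (by simpa using this)
    · rw [hwt, hE0, hE1]; push_cast; simp; ring
  -- On the edge G is a binary form in S and T. A root l of its dehomogenization gives the factor S
  -- - l T, and l ≠ 0 because the T^g coefficient is nonzero.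
  obtain ⟨l, hl⟩ : ∃ l : k, ∑ i ∈ Finset.range (g + 1), u i * l ^ i = 0 := by
    let U : Polynomial k := ∑ i ∈ Finset.range (g + 1), Polynomial.C (u i) * Polynomial.X ^ i
    have hc : U.coeff g = u g := by
      simp [U, Polynomial.finsetSum_coeff, Polynomial.coeff_C_mul, Polynomial.coeff_X_pow]
    have hdeg : U.degree ≠ 0 := by
      intro h
      have := Polynomial.coeff_eq_zero_of_degree_lt (p := U) (n := g) (by
        rw [h]; exact_mod_cast hg)
      exact hug (hc ▸ this)
    obtain ⟨l, hl⟩ := IsAlgClosed.exists_root U hdeg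
    refine ⟨l, ?_⟩
    simpa [U, Polynomial.IsRoot, Polynomial.eval_finsetSum] using hl
  have hl0 : l ≠ 0 := by
    rintro rfl
    rw [Finset.sum_eq_single 0] at hl
    · simp at hl; exact hu0 hl
    · intro i _ hi; simp [hi]
    · simp
  have hlC : ∑ i ∈ Finset.range (g + 1), C (u i) * T ^ (g - i) * (C l * T) ^ i = 0 := by
    have : ∀ i ∈ Finset.range (g + 1), C (u i) * T ^ (g - i) * (C l * T) ^ i =
        T ^ g * C (u i * l ^ i) := by
      intro i hi
      rw [Finset.mem_range] at hi
      rw [mul_pow, C_mul, C_pow, show T ^ g = T ^ (g - i) * T ^ i by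
        rw [← pow_add]; congr 1; omega]
      ring
    rw [Finset.sum_congr rfl this, ← Finset.mul_sum, ← map_sum, hl, C_0, mul_zero]
  have hρG : S - C l * T ∣ G := by
    have : G = ∑ i ∈ Finset.range (g + 1), C (u i) * T ^ (g - i) * (S ^ i - (C l * T) ^ i) := by
      simp only [mul_sub, Finset.sum_sub_distrib, hlC, sub_zero]
      rw [hGsum]
      exact Finset.sum_congr rfl fun i _ => by ring
    rw [this]
    exact Finset.dvd_sum fun i _ => (sub_dvd_pow_sub_pow S (C l * T) i).mul_left _
  have hρ : δ' (S - C l * T) = 0 := apply_eq_zero_of_dvd hδ' hG0 hk hρG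
  -- Both G and the power of S - l T lie in the kernel and their S^g terms agree. If they differed,
  -- their difference would be a nonzero kernel element divisible by T, so T and then S would be
  -- killed.
  have hTdvd : T ∣ G - C (u g) * (S - C l * T) ^ g := by
    have e : G - C (u g) * (S - C l * T) ^ g =
        ∑ i ∈ Finset.range g, C (u i) * S ^ i * T ^ (g - i) -
          C (u g) * ((S - C l * T) ^ g - S ^ g) := by
      rw [hGsum, Finset.sum_range_succ]
      simp
      ring
    rw [e]
    refine dvd_sub (Finset.dvd_sum fun i hi => ?_) (Dvd.dvd.mul_left ?_ _)
    · rw [Finset.mem_range] at hi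
      exact (dvd_pow_self T (by omega)).mul_left _
    · refine Dvd.dvd.trans ?_ (sub_dvd_pow_sub_pow _ _ _)
      exact ⟨-C l, by ring⟩
  have hGeq : G = C (u g) * (S - C l * T) ^ g := by
    by_contra hne
    have hT0 : δ' T = 0 := by
      refine apply_eq_zero_of_dvd hδ' (sub_ne_zero.2 hne) ?_ hTdvd
      rw [map_sub, hk, Derivation.leibniz, Derivation.leibniz_pow, hρ]
      simp
    have hS0 : δ' S = 0 := by
      have := hρ
      rw [map_sub, Derivation.leibniz, hT0] at this
      simpa using this
    have hp : ∀ (i : Fin 2) (m : ℕ), m ≠ 0 → δ' (X i ^ m) = 0 → δ' (X i) = 0 :=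
      fun i m hm h => apply_eq_zero_of_dvd hδ' (pow_ne_zero m (X_ne_zero i)) h (dvd_pow_self _ hm)
    exact hδ'0 (eq_zero_of_apply_X (i := 0) (j := 1) (by decide) (hp 0 b hb hS0) (hp 1 a ha hT0))
  exact ⟨a, b, g, u g, l, hug, hl0, by rw [hm, mul_comm], by rw [hr, mul_comm],
    eq_one_or_eq_one_of_apply_eq_zero hδ' hδ'0 ha hb hl0 hρ, htop, hGeq⟩

end LeadingForm

/-! ### Shears and the reduction of the degree of a kernel element. -/

section Shear

variable {k : Type*} [Field k]

/-- The substitution `y ↦ y`, `z ↦ z + h(y)`. -/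
noncomputable def shearHom (h : Polynomial k) :
    MvPolynomial (Fin 2) k →ₐ[k] MvPolynomial (Fin 2) k :=
  aeval ![X 0, X 1 + Polynomial.aeval (X 0) h]

@[simp] theorem shearHom_X_zero (h : Polynomial k) : shearHom h (X 0) = X 0 := by
  rw [shearHom, aeval_X]; rfl

@[simp] theorem shearHom_X_one (h : Polynomial k) :
    shearHom h (X 1) = X 1 + Polynomial.aeval (X 0) h := by
  rw [shearHom, aeval_X]; rfl

theorem shearHom_comp (h₁ h₂ : Polynomial k) :
    (shearHom h₁).comp (shearHom h₂) = shearHom (h₁ + h₂) := by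
  refine MvPolynomial.algHom_ext fun i => ?_
  fin_cases i
  · simp
  · simp [← Polynomial.aeval_algHom_apply, add_assoc]

theorem shearHom_zero : shearHom (0 : Polynomial k) = AlgHom.id k _ := by
  refine MvPolynomial.algHom_ext fun i => ?_
  fin_cases i <;> simp

/-- The automorphism `y ↦ y`, `z ↦ z + h(y)`. -/
noncomputable def shear (h : Polynomial k) :
    MvPolynomial (Fin 2) k ≃ₐ[k] MvPolynomial (Fin 2) k :=
  AlgEquiv.ofAlgHom (shearHom h) (shearHom (-h))
    (by rw [shearHom_comp, add_neg_cancel, shearHom_zero])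
    (by rw [shearHom_comp, neg_add_cancel, shearHom_zero])

@[simp] theorem shear_X_zero (h : Polynomial k) : shear h (X 0) = X 0 := shearHom_X_zero h

@[simp] theorem shear_X_one (h : Polynomial k) :
    shear h (X 1) = X 1 + Polynomial.aeval (X 0) h := shearHom_X_one h

theorem shear_shear (h₁ h₂ : Polynomial k) (p : MvPolynomial (Fin 2) k) :
    shear h₁ (shear h₂ p) = shear (h₁ + h₂) p :=
  DFunLike.congr_fun (shearHom_comp h₁ h₂) p

theorem shear_zero (p : MvPolynomial (Fin 2) k) : shear 0 p = p :=
  DFunLike.congr_fun shearHom_zero p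

/-- The automorphism exchanging the two variables. -/
noncomputable def swapEquiv (k : Type*) [Field k] :
    MvPolynomial (Fin 2) k ≃ₐ[k] MvPolynomial (Fin 2) k :=
  renameEquiv k (Equiv.swap 0 1)

@[simp] theorem swapEquiv_X_zero : swapEquiv k (X 0) = X 1 := by simp [swapEquiv]

@[simp] theorem swapEquiv_X_one : swapEquiv k (X 1) = X 0 := by simp [swapEquiv]

theorem degreeOf_zero_swapEquiv (p : MvPolynomial (Fin 2) k) :
    degreeOf 0 (swapEquiv k p) = degreeOf 1 p := by
  have := degreeOf_rename_of_injective (p := p) (Equiv.swap (0 : Fin 2) 1).injective 1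
  rwa [Equiv.swap_apply_right] at this

theorem degreeOf_one_swapEquiv (p : MvPolynomial (Fin 2) k) :
    degreeOf 1 (swapEquiv k p) = degreeOf 0 p := by
  have := degreeOf_rename_of_injective (p := p) (Equiv.swap (0 : Fin 2) 1).injective 0
  rwa [Equiv.swap_apply_left] at this

/-- For the weights (1, b) the polynomial z + l y^b is homogeneous of the same weight as z. -/
theorem WeightLE.shear {b : ℕ} {l : k} {d : ℤ} {p : MvPolynomial (Fin 2) k}
    (hp : WeightLE ![((1 : ℕ) : ℤ), (b : ℤ)] d p) :
    WeightLE ![((1 : ℕ) : ℤ), (b : ℤ)] d (shear (Polynomial.C l * Polynomial.X ^ b) p) := by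
  rw [p.as_sum, map_sum]
  refine WeightLE.sum _ fun m hm => ?_
  refine WeightLE.mono (d := Finsupp.weight ![((1 : ℕ) : ℤ), (b : ℤ)] m) ?_
    (hp m (mem_support_iff.1 hm))
  refine IsWeightedHomogeneous.weightLE ?_
  have hX := fun i => isWeightedHomogeneous_X k ![((1 : ℕ) : ℤ), (b : ℤ)] i
  have h1 : IsWeightedHomogeneous ![((1 : ℕ) : ℤ), (b : ℤ)]
      (X 1 + C l * X 0 ^ b : MvPolynomial (Fin 2) k) b := by
    refine (hX 1).add (IsWeightedHomogeneous.C_mul ?_ l)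
    simpa using (hX 0).pow b
  have h2 := ((isWeightedHomogeneous_C ![((1 : ℕ) : ℤ), (b : ℤ)] (coeff m p)).mul
    ((hX 0).pow (m 0))).mul (h1.pow (m 1))
  rw [monomial_eq, Finsupp.prod_fintype _ _ (by simp), Fin.prod_univ_two]
  rw [weight_fin_two]
  rw [map_mul, ← algebraMap_eq, AlgEquiv.commutes]
  simpa [mul_assoc] using h2

variable [CharZero k] [IsAlgClosed k]
  {δ : Derivation k (MvPolynomial (Fin 2) k) (MvPolynomial (Fin 2) k)}
  {F : MvPolynomial (Fin 2) k}

/-- A kernel element can be simplified by a shear. -/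
theorem exists_shear (hδ : IsLocallyNilpotent δ) (hδ0 : δ ≠ 0) (hF : δ F = 0)
    (h1 : degreeOf 1 F ≠ 0) (hle : degreeOf 1 F ≤ degreeOf 0 F) :
    ∃ (b : ℕ) (l : k), b ≠ 0 ∧ l ≠ 0 ∧ degreeOf 0 F = degreeOf 1 F * b ∧
      F.totalDegree = degreeOf 0 F ∧
      degreeOf 1 (shear (Polynomial.C l * Polynomial.X ^ b) F) = degreeOf 1 F ∧
      degreeOf 0 (shear (Polynomial.C l * Polynomial.X ^ b) F) < degreeOf 0 F := by
  classical
  obtain ⟨a, b, g, c, l, hc, hl, hm, hr, hab, hF1, hF2⟩ :=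
    exists_leading_form hδ hδ0 hF (by omega) h1
  have hg : 0 < g := Nat.pos_of_ne_zero (by rintro rfl; simp at hr; exact h1 hr)
  -- If b = 1, then g a ≤ g b still forces a = 1.
  obtain rfl : a = 1 := by
    rcases hab with h | rfl
    · exact h
    · rw [hm, hr] at hle
      have := Nat.le_of_mul_le_mul_left hle hg
      have : a ≠ 0 := by rintro rfl; simp at hr; exact h1 hr
      omega
  have hb : b ≠ 0 := by rintro rfl; simp at hm; omega
  rw [mul_one] at hr
  set w : Fin 2 → ℤ := ![((1 : ℕ) : ℤ), (b : ℤ)] with hw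
  have hwt : ∀ ν : Fin 2 →₀ ℕ, Finsupp.weight w ν = ν 0 + ν 1 * b := fun ν => by
    rw [weight_fin_two]; simp
  -- The inverse of l is chosen so that y^b - l z becomes -l z, and the leading form collapses to a
  -- pure power of z.
  set τ := shear (Polynomial.C l⁻¹ * Polynomial.X ^ b) with hτ
  have hG : τ (weightedHomogeneousComponent w (((1 : ℕ) : ℤ) * b * g) F) =
      monomial (Finsupp.single 1 g) (c * (-l) ^ g) := by
    have h : (X 0 : MvPolynomial (Fin 2) k) ^ b - C l * (X 1 + C l⁻¹ * X 0 ^ b) = C (-l) * X 1 := by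
      have : (C l * C l⁻¹ : MvPolynomial (Fin 2) k) = 1 := by
        rw [← C_mul, mul_inv_cancel₀ hl, C_1]
      rw [C_neg]
      linear_combination (-X 0 ^ b) * this
    rw [hF2, hτ]
    simp only [map_mul, map_pow, map_sub, shear_X_zero, shear_X_one, Polynomial.aeval_C,
      Polynomial.aeval_X, pow_one, AlgEquiv.commutes, ← algebraMap_eq]
    rw [algebraMap_eq, h, mul_pow, ← C_pow, X_pow_eq_monomial, C_mul_monomial, C_mul_monomial,
      mul_one]
  have hdec : τ F = monomial (Finsupp.single 1 g) (c * (-l) ^ g) +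
      τ (F - weightedHomogeneousComponent w (((1 : ℕ) : ℤ) * b * g) F) := by
    rw [map_sub, hG]; ring
  have hlow : WeightLE w (((1 : ℕ) : ℤ) * b * g - 1)
      (τ (F - weightedHomogeneousComponent w (((1 : ℕ) : ℤ) * b * g) F)) :=
    hF1.sub_component.shear
  -- All monomials other than z^g now lie strictly below the edge, which gives the strict drop in
  -- y-degree.
  have hco : ∀ ν, coeff ν (τ F) ≠ 0 → ν = Finsupp.single 1 g ∨ ν 0 + ν 1 * b < g * b := by
    intro ν hν
    by_cases h : ν = Finsupp.single 1 g
    · exact Or.inl h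
    · right
      rw [hdec, coeff_add, coeff_monomial, if_neg (Ne.symm h), zero_add] at hν
      have := hlow ν hν
      rw [hwt] at this
      push_cast at this
      zify
      linarith
  have htop : coeff (Finsupp.single 1 g) (τ F) ≠ 0 := by
    rw [hdec, coeff_add, coeff_monomial, if_pos rfl]
    have : coeff (Finsupp.single 1 g)
        (τ (F - weightedHomogeneousComponent w (((1 : ℕ) : ℤ) * b * g) F)) = 0 := by
      by_contra h
      have := hlow _ h
      rw [hwt] at this
      simp at this
      linarith
    rw [this, add_zero]
    exact mul_ne_zero hc (pow_ne_zero _ (neg_ne_zero.2 hl))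
  refine ⟨b, l⁻¹, hb, inv_ne_zero hl, by rw [hm, hr], ?_, ?_, ?_⟩
  · refine le_antisymm (Finset.sup_le fun ν hν => ?_) (degreeOf_le_totalDegree F 0)
    have := hF1 ν (mem_support_iff.1 hν)
    rw [hwt] at this
    push_cast at this
    have h2 : ν 0 + ν 1 * b ≤ g * b := by zify; linarith
    rw [Finsupp.sum_fintype _ _ (by simp), Fin.sum_univ_two, hm]
    have : ν 1 * 1 ≤ ν 1 * b := Nat.mul_le_mul_left _ (Nat.one_le_iff_ne_zero.2 hb)
    omega
  · rw [hr]
    refine le_antisymm (degreeOf_le_iff.2 fun ν hν => ?_) ?_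
    · rcases hco ν (mem_support_iff.1 hν) with h | h
      · simp [h]
      · refine Nat.le_of_mul_le_mul_right (?_ : ν 1 * b ≤ g * b) (Nat.pos_of_ne_zero hb)
        omega
    · simpa using le_degreeOf htop 1
  · rw [degreeOf_lt_iff (by omega), hm]
    intro ν hν
    rcases hco ν (mem_support_iff.1 hν) with h | h
    · simp only [h]
      simpa using ⟨hg, Nat.pos_of_ne_zero hb⟩
    · exact lt_of_le_of_lt (Nat.le_add_right _ _) h

end Shear

/-! ### Rentschler's theorem. -/

section Rentschler

variable {k : Type*} [Field k]

theorem algEquiv_eq_aeval {n : ℕ} (θ : MvPolynomial (Fin n) k ≃ₐ[k] MvPolynomial (Fin n) k)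
    (p : MvPolynomial (Fin n) k) : θ p = aeval (fun i => θ (X i)) p := by
  have h : θ.toAlgHom = aeval fun i => θ (X i) :=
    MvPolynomial.algHom_ext fun i => by rw [aeval_X]; rfl
  rw [← h]
  rfl

theorem isCoordinateSystem_algEquiv {n : ℕ}
    (θ : MvPolynomial (Fin n) k ≃ₐ[k] MvPolynomial (Fin n) k) :
    IsCoordinateSystem fun i => θ (X i) := by
  refine ⟨fun a b hab => θ.injective ?_, fun b => ⟨θ.symm b, ?_⟩⟩
  · rw [algEquiv_eq_aeval θ a, algEquiv_eq_aeval θ b]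
    exact hab
  · exact (algEquiv_eq_aeval θ _).symm.trans (θ.apply_symm_apply b)

theorem exists_eq_aeval_of_degreeOf_eq_zero {i j : Fin 2} (hij : i ≠ j)
    {F : MvPolynomial (Fin 2) k} (h : degreeOf j F = 0) :
    ∃ u : Polynomial k, F = Polynomial.aeval (X i) u := by
  refine ⟨∑ m ∈ F.support, Polynomial.C (coeff m F) * Polynomial.X ^ m i, ?_⟩
  rw [map_sum]
  conv_lhs => rw [F.as_sum]
  refine Finset.sum_congr rfl fun m hm => ?_
  have hj : m j = 0 := Nat.le_zero.1 (h ▸ monomial_le_degreeOf j hm)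
  rw [map_mul, map_pow, Polynomial.aeval_C, Polynomial.aeval_X, algebraMap_eq,
    X_pow_eq_monomial, C_mul_monomial, mul_one]
  congr 2
  ext l
  fin_cases i <;> fin_cases j <;> fin_cases l <;> simp_all

theorem X_sub_C_dvd_aeval [IsAlgClosed k] {R : Type*} [CommRing R] [Algebra k R] (x : R)
    {u : Polynomial k} (hu : u.natDegree ≠ 0) : ∃ l : k, x - algebraMap k R l ∣
      Polynomial.aeval x u := by
  obtain ⟨l, hl⟩ := IsAlgClosed.exists_root u fun h =>
    hu (Polynomial.natDegree_eq_of_degree_eq_some h)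
  refine ⟨l, ?_⟩
  have := map_dvd (Polynomial.aeval x) (Polynomial.dvd_iff_isRoot.2 hl)
  simpa using this

theorem IsIrreducible.ne_zero {n : ℕ}
    {δ : Derivation k (MvPolynomial (Fin (n + 1)) k) (MvPolynomial (Fin (n + 1)) k)}
    (hirr : IsIrreducible δ) : δ ≠ 0 := by
  rintro rfl
  exact X_prime.not_isUnit (hirr (X 0) fun a => dvd_zero _)

variable {δ : Derivation k (MvPolynomial (Fin 2) k) (MvPolynomial (Fin 2) k)}

/-- An irreducible derivation of the plane that kills a variable is its Jacobian derivation, up to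
a constant. -/
theorem apply_eq_of_variable (hirr : IsIrreducible δ)
    (θ : MvPolynomial (Fin 2) k ≃ₐ[k] MvPolynomial (Fin 2) k) (hθ : δ (θ (X 0)) = 0) :
    ∃ γ : k, γ ≠ 0 ∧ ∀ p,
      δ p = C γ * (pderiv 0 (θ (X 0)) * pderiv 1 p - pderiv 1 (θ (X 0)) * pderiv 0 p) := by
  have hθv := algEquiv_eq_aeval θ
  have hv := isCoordinateSystem_algEquiv θ
  have hform : ∀ (d : Derivation k (MvPolynomial (Fin 2) k) (MvPolynomial (Fin 2) k)) (q),
      d (θ q) = θ (pderiv 0 q) * d (θ (X 0)) + θ (pderiv 1 q) * d (θ (X 1)) := by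
    intro d q
    rw [hθv q, derivation_aeval, Fin.sum_univ_two, ← hθv, ← hθv]
  -- As δ kills θ (X 0), its whole image is divisible by δ (θ (X 1)), which irreducibility makes a
  -- unit.
  have hunit : IsUnit (δ (θ (X 1))) := by
    refine hirr _ fun a => ?_
    obtain ⟨q, rfl⟩ := θ.surjective a
    rw [hform δ q, hθ, mul_zero, zero_add]
    exact dvd_mul_left _ _
  obtain ⟨α, hα, hα'⟩ := isUnit_iff_eq_C_of_isReduced.1 hunit
  obtain ⟨κ, hκ, hκ'⟩ := isUnit_iff_eq_C_of_isReduced.1 hv.isUnit_det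
  rw [Matrix.det_fin_two] at hκ'
  simp only [jacobianMatrix, Matrix.of_apply] at hκ'
  refine ⟨α / κ, div_ne_zero hα.ne_zero hκ.ne_zero, fun p => ?_⟩
  obtain ⟨q, rfl⟩ := θ.surjective p
  have hcc : (C (α / κ) * C κ : MvPolynomial (Fin 2) k) = C α := by
    rw [← C_mul, div_mul_cancel₀ _ hκ.ne_zero]
  rw [hform δ q, hform (pderiv 0) q, hform (pderiv 1) q, hθ, hα', ← hcc, ← hκ']
  ring

variable [CharZero k]

theorem exists_derivative_eq (u : Polynomial k) :
    ∃ q : Polynomial k, Polynomial.derivative q = u := by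
  induction u using Polynomial.induction_on' with
  | add p q hp hq =>
    obtain ⟨p', rfl⟩ := hp
    obtain ⟨q', rfl⟩ := hq
    exact ⟨p' + q', Polynomial.derivative_add⟩
  | monomial n a =>
    refine ⟨Polynomial.monomial (n + 1) (a / (n + 1)), ?_⟩
    rw [Polynomial.derivative_monomial]
    have : ((n : k) + 1) ≠ 0 := Nat.cast_add_one_ne_zero n
    simp [this]

/-- If the kernel were k, some t would satisfy δ t = 1, and integrating repeatedly would write every
polynomial as a polynomial in t. Two independent variables cannot both be such. -/
theorem exists_nonconstant_apply_eq_zero (hδ : IsLocallyNilpotent δ) (hδ0 : δ ≠ 0) :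
    ∃ F, δ F = 0 ∧ ∀ a, F ≠ C a := by
  by_contra! hker
  obtain ⟨b, hb⟩ : ∃ b, δ b ≠ 0 := by
    by_contra! h
    exact hδ0 (Derivation.ext fun b => by rw [h b]; rfl)
  obtain ⟨i, hi⟩ := exists_hasTop (fun h => hb (by rw [h, map_zero])) (hδ b)
  obtain ⟨i, rfl, hi'⟩ := hi.pred hb
  rw [HasTop, Function.iterate_succ_apply' _ (i + 1), Function.iterate_succ_apply' _ i] at hi
  obtain ⟨a, ha⟩ := hker _ hi.2
  have ha0 : a ≠ 0 := by rintro rfl; exact hi.1 (by rw [ha, C_0])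
  set t := a⁻¹ • (⇑δ)^[i] b with ht
  have hδt : δ t = 1 := by
    rw [ht, Derivation.map_smul, ha, smul_eq_C_mul, ← C_mul, inv_mul_cancel₀ ha0, C_1]
  have hall : ∀ (N : ℕ) (p : MvPolynomial (Fin 2) k), (⇑δ)^[N] p = 0 →
      ∃ u : Polynomial k, p = Polynomial.aeval t u := by
    intro N
    induction N with
    | zero => intro p hp; exact ⟨0, by simpa using hp⟩
    | succ N ih =>
      intro p hp
      obtain ⟨u, hu⟩ := ih (δ p) hp
      obtain ⟨q, rfl⟩ := exists_derivative_eq u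
      obtain ⟨e, he⟩ := hker (p - Polynomial.aeval t q) (by
        rw [Derivation.map_sub, Derivation.map_aeval, hδt, hu]; simp)
      refine ⟨q + Polynomial.C e, ?_⟩
      rw [map_add, Polynomial.aeval_C, algebraMap_eq, ← he]
      ring
  have hX : ∀ i : Fin 2, ∃ u : Polynomial k, X i = Polynomial.aeval t u := fun i =>
    let ⟨N, hN⟩ := hδ (X i); hall N _ hN
  obtain ⟨u0, hu0⟩ := hX 0
  obtain ⟨u1, hu1⟩ := hX 1
  have e00 := congrArg (pderiv 0) hu0
  have e10 := congrArg (pderiv 0) hu1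
  have e11 := congrArg (pderiv 1) hu1
  rw [Derivation.map_aeval] at e00 e10 e11
  simp only [pderiv_X_self, pderiv_X_of_ne (show (1 : Fin 2) ≠ 0 by decide), smul_eq_mul]
    at e00 e10 e11
  rcases mul_eq_zero.1 e10.symm with h | h
  · rw [h, zero_mul] at e11; exact one_ne_zero e11
  · rw [h, mul_zero] at e00; exact one_ne_zero e00

variable [IsAlgClosed k]

/-- A nonconstant polynomial in one variable has a factor `X i - l`, which the factorially closed
kernel contains. -/
theorem apply_X_eq_zero_of_degreeOf_eq_zero (hδ : IsLocallyNilpotent δ) {i j : Fin 2} (hij : i ≠ j)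
    {F : MvPolynomial (Fin 2) k} (hF : δ F = 0) (hFC : ∀ a, F ≠ C a) (h : degreeOf j F = 0) :
    δ (X i) = 0 := by
  obtain ⟨u, rfl⟩ := exists_eq_aeval_of_degreeOf_eq_zero hij h
  have hu : u.natDegree ≠ 0 := by
    intro h0
    rw [Polynomial.eq_C_of_natDegree_eq_zero h0] at hFC
    exact hFC _ (Polynomial.aeval_C _ _)
  obtain ⟨l, hl⟩ := X_sub_C_dvd_aeval (X i : MvPolynomial (Fin 2) k) hu
  have := apply_eq_zero_of_dvd hδ (fun h0 => hFC 0 (by rw [h0, C_0])) hF hl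
  rwa [Derivation.map_sub, Derivation.map_algebraMap, sub_zero] at this

/-- **Rentschler's theorem**: a nonzero locally nilpotent derivation of the plane kills a
variable. -/
theorem exists_variable_apply_eq_zero (hδ : IsLocallyNilpotent δ) (hδ0 : δ ≠ 0) :
    ∃ θ : MvPolynomial (Fin 2) k ≃ₐ[k] MvPolynomial (Fin 2) k, δ (θ (X 0)) = 0 := by
  obtain ⟨F, hF, hFC⟩ := exists_nonconstant_apply_eq_zero hδ hδ0
  -- Induct on the sum of the partial degrees of a nonconstant kernel element: a shear, after a swap
  -- if necessary, lowers it until one of the degrees is 0.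
  generalize hN : degreeOf 0 F + degreeOf 1 F = N
  induction N using Nat.strong_induction_on generalizing δ F with
  | _ N ih =>
  subst hN
  have hconj : ∀ (τ : MvPolynomial (Fin 2) k ≃ₐ[k] MvPolynomial (Fin 2) k),
      (∃ θ : MvPolynomial (Fin 2) k ≃ₐ[k] MvPolynomial (Fin 2) k, conj τ δ (θ (X 0)) = 0) →
      ∃ θ : MvPolynomial (Fin 2) k ≃ₐ[k] MvPolynomial (Fin 2) k, δ (θ (X 0)) = 0 := by
    rintro τ ⟨θ, hθ⟩
    refine ⟨θ.trans τ.symm, τ.injective ?_⟩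
    rwa [map_zero]
  have hC : ∀ (τ : MvPolynomial (Fin 2) k ≃ₐ[k] MvPolynomial (Fin 2) k) a, τ F ≠ C a := by
    intro τ a h
    refine hFC a (τ.injective ?_)
    rw [h]
    exact (τ.commutes a).symm
  by_cases h1 : degreeOf 1 F = 0
  · exact ⟨AlgEquiv.refl, apply_X_eq_zero_of_degreeOf_eq_zero hδ (by decide) hF hFC h1⟩
  by_cases h0 : degreeOf 0 F = 0
  · refine ⟨swapEquiv k, ?_⟩
    rw [swapEquiv_X_zero]
    exact apply_X_eq_zero_of_degreeOf_eq_zero hδ (by decide) hF hFC h0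
  have hstep : ∀ τ : MvPolynomial (Fin 2) k ≃ₐ[k] MvPolynomial (Fin 2) k,
      degreeOf 0 (τ F) + degreeOf 1 (τ F) < degreeOf 0 F + degreeOf 1 F →
      ∃ θ : MvPolynomial (Fin 2) k ≃ₐ[k] MvPolynomial (Fin 2) k, δ (θ (X 0)) = 0 :=
    fun τ hlt => hconj τ (ih _ hlt (conj_locallyNilpotent τ hδ) (conj_ne_zero τ hδ0) (τ F)
      (by rw [conj_apply_apply, hF, map_zero]) (hC τ) rfl)
  rcases le_total (degreeOf 1 F) (degreeOf 0 F) with hle | hle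
  · obtain ⟨b, l, -, -, -, -, e1, e0⟩ := exists_shear hδ hδ0 hF h1 hle
    exact hstep (shear (Polynomial.C l * Polynomial.X ^ b)) (by omega)
  · have hδ' := conj_locallyNilpotent (swapEquiv k) hδ
    obtain ⟨b, l, -, -, -, -, e1, e0⟩ := exists_shear hδ' (conj_ne_zero _ hδ0)
      (F := swapEquiv k F) (by rw [conj_apply_apply, hF, map_zero])
      (by rwa [degreeOf_one_swapEquiv]) (by rwa [degreeOf_one_swapEquiv, degreeOf_zero_swapEquiv])
    rw [degreeOf_one_swapEquiv] at e1
    rw [degreeOf_zero_swapEquiv] at e0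
    refine hstep ((swapEquiv k).trans (shear (Polynomial.C l * Polynomial.X ^ b))) ?_
    rw [AlgEquiv.trans_apply]
    omega

end Rentschler

/-! ### Dehomogenization with respect to a linear system of variables. -/

section Dehomogenize

variable {k : Type*} [Field k]

/-- Setting the first variable to `1`. -/
noncomputable def dehomogenize : MvPolynomial (Fin 3) k →ₐ[k] MvPolynomial (Fin 2) k :=
  aeval ![1, X 0, X 1]

theorem dehomogenize_monomial (m : Fin 3 →₀ ℕ) (a : k) :
    dehomogenize (monomial m a) = monomial (Finsupp.single 0 (m 1) + Finsupp.single 1 (m 2)) a := by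
  rw [dehomogenize, aeval_monomial, Finsupp.prod_fintype _ _ (by simp), Fin.prod_univ_three]
  simp only [Matrix.cons_val_zero, Matrix.cons_val_one, Matrix.cons_val, one_pow, one_mul,
    algebraMap_eq, X_pow_eq_monomial, monomial_mul, C_mul_monomial, mul_one]

theorem dehomogenize_eq_sum (p : MvPolynomial (Fin 3) k) :
    dehomogenize p = ∑ m ∈ p.support,
      monomial (Finsupp.single 0 (m 1) + Finsupp.single 1 (m 2)) (coeff m p) := by
  conv_lhs => rw [p.as_sum, map_sum]
  exact Finset.sum_congr rfl fun m _ => dehomogenize_monomial _ _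

theorem degree_le_totalDegree {n : ℕ} {p : MvPolynomial (Fin n) k} {m : Fin n →₀ ℕ}
    (hm : coeff m p ≠ 0) : m.degree ≤ p.totalDegree :=
  le_totalDegree (mem_support_iff.2 hm)

theorem totalDegree_le_of_degree_le {n d : ℕ} {p : MvPolynomial (Fin n) k}
    (h : ∀ m, coeff m p ≠ 0 → m.degree ≤ d) : p.totalDegree ≤ d :=
  Finset.sup_le fun m hm => h m (mem_support_iff.1 hm)

theorem degree_fin_three (m : Fin 3 →₀ ℕ) : m.degree = m 0 + m 1 + m 2 := by
  rw [Finsupp.degree_eq_sum, Fin.sum_univ_three]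

theorem degree_fin_two (m : Fin 2 →₀ ℕ) : m.degree = m 0 + m 1 := by
  rw [Finsupp.degree_eq_sum, Fin.sum_univ_two]

/-- The total degree and the last two exponents determine the first exponent, so distinct monomials
of a form stay distinct. -/
theorem eq_zero_of_dehomogenize_eq_zero {d : ℕ} {p : MvPolynomial (Fin 3) k}
    (hp : p.IsHomogeneous d) (h : dehomogenize p = 0) : p = 0 := by
  classical
  by_contra hne
  obtain ⟨m, hm⟩ := support_nonempty.2 hne
  have hd := fun m (hm : m ∈ p.support) => hp.degree_eq_sum_deg_support hm
  simp only [← Finsupp.degree_apply, degree_fin_three] at hd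
  rw [dehomogenize_eq_sum] at h
  have := congrArg (coeff (Finsupp.single 0 (m 1) + Finsupp.single 1 (m 2))) h
  rw [coeff_sum, Finset.sum_eq_single m] at this
  · rw [coeff_monomial, if_pos rfl] at this
    exact mem_support_iff.1 hm (by simpa using this)
  · intro m' hm' hne'
    rw [coeff_monomial, if_neg]
    intro he
    have h1 := DFunLike.congr_fun he 0
    have h2 := DFunLike.congr_fun he 1
    simp at h1 h2
    have e := hd m hm
    have e' := hd m' hm'
    refine hne' (Finsupp.ext fun i => ?_)
    fin_cases i
    · change m' 0 = m 0
      omega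
    · exact h1
    · exact h2
  · intro hn; exact absurd hm hn

theorem totalDegree_dehomogenize_le {d : ℕ} {p : MvPolynomial (Fin 3) k}
    (hp : p.IsHomogeneous d) : (dehomogenize p).totalDegree ≤ d := by
  rw [dehomogenize_eq_sum]
  refine totalDegree_finsetSum_le fun m hm => (totalDegree_monomial_le _ _).trans ?_
  have hd := hp.degree_eq_sum_deg_support hm
  simp only [← Finsupp.degree_apply, degree_fin_three] at hd
  change Finsupp.degree _ ≤ d
  rw [degree_fin_two]
  simp
  omega

theorem exists_dehomogenize_eq {d : ℕ} {b : MvPolynomial (Fin 2) k} (hb : b.totalDegree ≤ d) :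
    ∃ p : MvPolynomial (Fin 3) k, p.IsHomogeneous d ∧ dehomogenize p = b := by
  refine ⟨∑ m ∈ b.support, monomial (Finsupp.single 0 (d - m.degree) + Finsupp.single 1 (m 0) +
    Finsupp.single 2 (m 1)) (coeff m b), IsHomogeneous.sum _ _ _ fun m hm => ?_, ?_⟩
  · refine isHomogeneous_monomial _ ?_
    have := (degree_le_totalDegree (mem_support_iff.1 hm)).trans hb
    rw [degree_fin_three]
    simp
    rw [degree_fin_two] at this ⊢
    omega
  · rw [map_sum]
    conv_rhs => rw [b.as_sum]
    refine Finset.sum_congr rfl fun m _ => ?_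
    rw [dehomogenize_monomial]
    congr 2
    ext i
    fin_cases i <;> simp

/-- `φ` is the dehomogenization with respect to the linear system of variables `v`. -/
structure Dehom (v : Fin 3 → MvPolynomial (Fin 3) k)
    (φ : MvPolynomial (Fin 3) k →ₐ[k] MvPolynomial (Fin 2) k) : Prop where
  linear : IsLinearCoordinateSystem v
  zero : φ (v 0) = 1
  one : φ (v 1) = X 0
  two : φ (v 2) = X 1

variable {v : Fin 3 → MvPolynomial (Fin 3) k}
  {φ : MvPolynomial (Fin 3) k →ₐ[k] MvPolynomial (Fin 2) k}

theorem Dehom.apply_aeval (h : Dehom v φ) (p : MvPolynomial (Fin 3) k) :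
    φ (aeval v p) = dehomogenize p := by
  have : φ.comp (aeval v) = dehomogenize := by
    refine MvPolynomial.algHom_ext fun i => ?_
    rw [AlgHom.comp_apply, aeval_X, dehomogenize, aeval_X]
    fin_cases i
    · exact h.zero
    · exact h.one
    · exact h.two
  rw [← this, AlgHom.comp_apply]

theorem exists_dehom (hv : IsLinearCoordinateSystem v) : ∃ φ, Dehom v φ := by
  obtain ⟨w, -, -, hwv⟩ := hv.exists_inverse
  have key : ∀ i, dehomogenize (aeval w (v i)) =
      (![1, X 0, X 1] : Fin 3 → MvPolynomial (Fin 2) k) i := by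
    intro i
    have : v i = aeval v (X i : MvPolynomial (Fin 3) k) := by rw [aeval_X]
    rw [this, hwv, dehomogenize, aeval_X]
  exact ⟨dehomogenize.comp (aeval w), hv, key 0, key 1, key 2⟩

theorem Dehom.eq_of_apply_eq (h : Dehom v φ) {d : ℕ} {p q : MvPolynomial (Fin 3) k}
    (hp : p.IsHomogeneous d) (hq : q.IsHomogeneous d) (hpq : φ p = φ q) : p = q := by
  obtain ⟨w, hw, hvw, -⟩ := h.linear.exists_inverse
  rw [← sub_eq_zero, ← hvw (p - q)]
  rw [eq_zero_of_dehomogenize_eq_zero (aeval_isHomogeneous hw.2 (hp.sub hq)), map_zero]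
  rw [← h.apply_aeval, hvw, map_sub, hpq, sub_self]

theorem Dehom.totalDegree_le (h : Dehom v φ) {d : ℕ} {p : MvPolynomial (Fin 3) k}
    (hp : p.IsHomogeneous d) : (φ p).totalDegree ≤ d := by
  obtain ⟨w, hw, hvw, -⟩ := h.linear.exists_inverse
  rw [← hvw p, h.apply_aeval]
  exact totalDegree_dehomogenize_le (aeval_isHomogeneous hw.2 hp)

theorem Dehom.exists_apply_eq (h : Dehom v φ) {d : ℕ} {b : MvPolynomial (Fin 2) k}
    (hb : b.totalDegree ≤ d) : ∃ p : MvPolynomial (Fin 3) k, p.IsHomogeneous d ∧ φ p = b := by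
  obtain ⟨p, hp, rfl⟩ := exists_dehomogenize_eq hb
  exact ⟨aeval v p, aeval_isHomogeneous h.linear.2 hp, h.apply_aeval p⟩

theorem Dehom.surjective (h : Dehom v φ) : Function.Surjective φ := fun _ =>
  let ⟨p, _, hp⟩ := h.exists_apply_eq le_rfl; ⟨p, hp⟩

end Dehomogenize

/-! ### The derivation of the plane induced by D. -/

section PlaneDerivation

variable {k : Type*} [Field k] {v : Fin 3 → MvPolynomial (Fin 3) k}
  {φ : MvPolynomial (Fin 3) k →ₐ[k] MvPolynomial (Fin 2) k}
  {D : Derivation k (MvPolynomial (Fin 3) k) (MvPolynomial (Fin 3) k)}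
  {δ : Derivation k (MvPolynomial (Fin 2) k) (MvPolynomial (Fin 2) k)}

/-- Since D kills v₀, it preserves the ideal generated by v₀ - 1. -/
theorem Dehom.exists_derivation (h : Dehom v φ) (hD0 : D (v 0) = 0) :
    ∃ δ : Derivation k (MvPolynomial (Fin 2) k) (MvPolynomial (Fin 2) k),
      ∀ b, φ (D b) = δ (φ b) := by
  let δ : Derivation k (MvPolynomial (Fin 2) k) (MvPolynomial (Fin 2) k) :=
    mkDerivation k ![φ (D (v 1)), φ (D (v 2))]
  refine ⟨δ, fun b => ?_⟩
  obtain ⟨p, rfl⟩ := h.linear.1.2 b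
  have e : ∀ i, δ ((![1, X 0, X 1] : Fin 3 → MvPolynomial (Fin 2) k) i) = φ (D (v i)) := by
    intro i
    fin_cases i
    · simp [hD0]
    · exact mkDerivation_X _ _ _
    · exact mkDerivation_X _ _ _
  rw [derivation_aeval, map_sum, h.apply_aeval, dehomogenize, derivation_aeval]
  refine Finset.sum_congr rfl fun l _ => ?_
  rw [map_mul, h.apply_aeval, e]
  rfl

theorem Dehom.locallyNilpotent (h : Dehom v φ) (hδ : ∀ b, φ (D b) = δ (φ b))
    (hD : IsLocallyNilpotent D) : IsLocallyNilpotent δ := by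
  intro b
  obtain ⟨p, rfl⟩ := h.surjective b
  obtain ⟨m, hm⟩ := hD p
  refine ⟨m, ?_⟩
  have hiter : ∀ (i : ℕ) (p), φ ((⇑D)^[i] p) = (⇑δ)^[i] (φ p) := by
    intro i
    induction i with
    | zero => intro p; rfl
    | succ i ih => intro p; rw [Function.iterate_succ_apply, Function.iterate_succ_apply, ih, hδ]
  rw [← hiter, hm, map_zero]

theorem dvd_apply_of_dvd_coordinates (hv : IsCoordinateSystem v) {b : MvPolynomial (Fin 3) k}
    (h : ∀ i, b ∣ D (v i)) (a : MvPolynomial (Fin 3) k) : b ∣ D a := by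
  obtain ⟨p, rfl⟩ := hv.2 a
  rw [derivation_aeval]
  exact Finset.dvd_sum fun i _ => (h i).mul_left _

/-- The cofactor of b has degree at most N - e, so it homogenizes to a form of degree N - e, and
forms of equal degree are determined by their images. -/
theorem Dehom.exists_dvd (h : Dehom v φ) {N e : ℕ} {b : MvPolynomial (Fin 2) k}
    {P a : MvPolynomial (Fin 3) k} (hP : P.IsHomogeneous e) (hb : φ P = b)
    (hbe : b.totalDegree = e) (ha : a.IsHomogeneous N) (hd : b ∣ φ a) (hb0 : b ≠ 0) : P ∣ a := by
  obtain ⟨c, hc⟩ := hd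
  rcases eq_or_ne c 0 with rfl | hc0
  · have : a = 0 := h.eq_of_apply_eq ha (isHomogeneous_zero _ _ _) (by rw [hc, mul_zero, map_zero])
    rw [this]
    exact dvd_zero _
  · have hdeg := h.totalDegree_le ha
    rw [hc, totalDegree_mul_of_isDomain hb0 hc0, hbe] at hdeg
    obtain ⟨Q, hQ, hQc⟩ := h.exists_apply_eq (d := N - e) (b := c) (by omega)
    have hPQ := hP.mul hQ
    rw [Nat.add_sub_cancel' (by omega)] at hPQ
    exact ⟨Q, h.eq_of_apply_eq ha hPQ (by rw [map_mul, hb, hQc, hc])⟩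

/-- A common divisor of the image of δ homogenizes to a common divisor of the image of D. -/
theorem Dehom.isIrreducible (h : Dehom v φ) (hδ : ∀ b, φ (D b) = δ (φ b))
    {d : ℕ} (hhom : IsHomogeneousOfDegree D d) (hirr : IsIrreducible D) : IsIrreducible δ := by
  intro b hb
  have hN : ∀ i, (D (v i)).IsHomogeneous (1 + d) := fun i => hhom 1 _ (h.linear.2 i)
  have hb0 : b ≠ 0 := by
    rintro rfl
    have hz : ∀ i, D (v i) = 0 := fun i => by
      refine h.eq_of_apply_eq (hN i) (isHomogeneous_zero _ _ _) ?_
      rw [hδ, zero_dvd_iff.1 (hb _), map_zero]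
    exact X_prime.not_isUnit (hirr (X 0) (dvd_apply_of_dvd_coordinates h.linear.1 fun i => by
      rw [hz i]; exact dvd_zero _))
  obtain ⟨P, hP, hPb⟩ := h.exists_apply_eq (b := b) le_rfl
  have hu := hirr P (dvd_apply_of_dvd_coordinates h.linear.1 fun i =>
    h.exists_dvd hP hPb rfl (hN i) (by rw [hδ]; exact hb _) hb0)
  rw [← hPb]
  exact hu.map φ

theorem coeff_pderiv_sub_single [CharZero k] {n : ℕ} {g : MvPolynomial (Fin n) k} {m : Fin n →₀ ℕ}
    (hm : coeff m g ≠ 0) {i : Fin n} (hi : m i ≠ 0) :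
    coeff (m - Finsupp.single i 1) (pderiv i g) ≠ 0 := by
  have h : m - Finsupp.single i 1 + Finsupp.single i 1 = m :=
    tsub_add_cancel_of_le (Finsupp.single_le_iff.2 (Nat.one_le_iff_ne_zero.2 hi))
  rw [coeff_pderiv, h]
  exact mul_ne_zero hm (Nat.cast_add_one_ne_zero _)

theorem totalDegree_pderiv_lt {n : ℕ} {g : MvPolynomial (Fin n) k} (hg : g.totalDegree ≠ 0)
    (i : Fin n) : (pderiv i g).totalDegree < g.totalDegree := by
  refine (Finset.sup_lt_iff (Nat.pos_of_ne_zero hg)).2 fun m hm => ?_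
  rw [mem_support_iff, coeff_pderiv] at hm
  have := degree_le_totalDegree (left_ne_zero_of_mul hm)
  rw [map_add, Finsupp.degree_single] at this
  change m.degree < _
  omega

/-- The partial derivatives of g are, up to constants, dehomogenizations of forms of degree d + 1,
which bounds deg g above. If deg g were smaller, those forms would all be divisible by v₀, against
irreducibility. -/
theorem Dehom.totalDegree_eq [CharZero k] (h : Dehom v φ) (hδ : ∀ b, φ (D b) = δ (φ b))
    (hD0 : D (v 0) = 0) {d : ℕ} (hhom : IsHomogeneousOfDegree D d)
    (hirr : IsIrreducible D) {g : MvPolynomial (Fin 2) k} {γ : k} (hγ : γ ≠ 0)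
    (hg : ∀ p, δ p = C γ * (pderiv 0 g * pderiv 1 p - pderiv 1 g * pderiv 0 p)) :
    g.totalDegree = d + 2 := by
  have hN : ∀ i, (D (v i)).IsHomogeneous (1 + d) := fun i => hhom 1 _ (h.linear.2 i)
  have e0 : δ (X 0) = (-γ) • pderiv 1 g := by
    rw [hg, smul_eq_C_mul]; simp
  have e1 : δ (X 1) = γ • pderiv 0 g := by
    rw [hg, smul_eq_C_mul]; simp
  have hs : ∀ (a : k), a ≠ 0 → ∀ q : MvPolynomial (Fin 2) k,
      (a • q).totalDegree = q.totalDegree := by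
    intro a ha q
    refine le_antisymm (totalDegree_smul_le a q) ?_
    conv_lhs => rw [← inv_smul_smul₀ ha q]
    exact totalDegree_smul_le _ _
  have d0 : (δ (X 0)).totalDegree = (pderiv 1 g).totalDegree := by rw [e0, hs _ (neg_ne_zero.2 hγ)]
  have d1 : (δ (X 1)).totalDegree = (pderiv 0 g).totalDegree := by rw [e1, hs _ hγ]
  have f0 : φ (D (v 1)) = δ (X 0) := by rw [hδ, h.one]
  have f1 : φ (D (v 2)) = δ (X 1) := by rw [hδ, h.two]
  have hle : ∀ i, (pderiv i g).totalDegree ≤ 1 + d := by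
    intro i
    fin_cases i
    · change (pderiv 0 g).totalDegree ≤ _
      rw [← d1, ← f1]; exact h.totalDegree_le (hN 2)
    · change (pderiv 1 g).totalDegree ≤ _
      rw [← d0, ← f0]; exact h.totalDegree_le (hN 1)
  refine le_antisymm ?_ ?_
  · refine totalDegree_le_of_degree_le fun m hm => ?_
    by_cases hm0 : m = 0
    · rw [hm0]; simp
    · obtain ⟨i, hi⟩ : ∃ i, m i ≠ 0 := by
        by_contra! hall
        exact hm0 (Finsupp.ext hall)
      have := (degree_le_totalDegree (coeff_pderiv_sub_single hm hi)).trans (hle i)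
      have h2 : m - Finsupp.single i 1 + Finsupp.single i 1 = m :=
        tsub_add_cancel_of_le (Finsupp.single_le_iff.2 (Nat.one_le_iff_ne_zero.2 hi))
      rw [← h2, map_add, Finsupp.degree_single]
      omega
  · by_contra! hlt
    have hlow : ∀ i, (pderiv i g).totalDegree ≤ d := by
      intro i
      by_cases h0 : g.totalDegree = 0
      · rw [totalDegree_eq_zero_iff_eq_C.1 h0, pderiv_C]; simp
      · have := totalDegree_pderiv_lt h0 i
        omega
    have hdvd : ∀ i, (φ (D (v i))).totalDegree ≤ d → v 0 ∣ D (v i) := by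
      intro i hi
      obtain ⟨p, hp, hpe⟩ := h.exists_apply_eq hi
      exact ⟨p, h.eq_of_apply_eq (hN i) ((h.linear.2 0).mul hp) (by
        rw [map_mul, h.zero, one_mul, hpe])⟩
    have hunit : IsUnit (v 0) := by
      refine hirr _ (dvd_apply_of_dvd_coordinates h.linear.1 fun i => ?_)
      fin_cases i
      · change v 0 ∣ D (v 0)
        rw [hD0]; exact dvd_zero _
      · exact hdvd 1 (by rw [f0, d0]; exact hlow 1)
      · exact hdvd 2 (by rw [f1, d1]; exact hlow 0)
    obtain ⟨w, -, -, hwv⟩ := h.linear.exists_inverse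
    have hX := hunit.map (aeval w : MvPolynomial (Fin 3) k →ₐ[k] MvPolynomial (Fin 3) k)
    have : v 0 = aeval v (X 0 : MvPolynomial (Fin 3) k) := by rw [aeval_X]
    rw [this, hwv] at hX
    exact X_prime.not_isUnit hX

end PlaneDerivation

/-! ### Linear changes of coordinates. -/

section LinearChange

variable {k : Type*} [Field k]

theorem isLinearCoordinateSystem_block {v : Fin 3 → MvPolynomial (Fin 3) k}
    (hv : IsLinearCoordinateSystem v) (a b c d : k) (hdet : a * d - b * c ≠ 0) :
    IsLinearCoordinateSystem ![v 0, C a * v 1 + C b * v 2, C c * v 1 + C d * v 2] := by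
  let M : Matrix (Fin 3) (Fin 3) k := !![1, 0, 0; 0, a, b; 0, c, d]
  have hM : IsUnit M.det := by
    rw [isUnit_iff_ne_zero]
    simpa [M, Matrix.det_fin_three] using hdet
  have h := hv.comp (isLinearCoordinateSystem_linearForms (Matrix.mul_nonsing_inv M hM))
  convert h using 1
  ext1 i
  fin_cases i <;> simp [linearForms, Fin.sum_univ_three, M, algHom_C, algebraMap_eq]

theorem IsLinearCoordinateSystem.comp_perm {n : ℕ} {v : Fin n → MvPolynomial (Fin n) k}
    (hv : IsLinearCoordinateSystem v) (σ : Equiv.Perm (Fin n)) :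
    IsLinearCoordinateSystem (v ∘ σ) := by
  refine ⟨?_, fun i => hv.2 (σ i)⟩
  have : (aeval (v ∘ σ) : MvPolynomial (Fin n) k →ₐ[k] MvPolynomial (Fin n) k) =
      (aeval v).comp (renameEquiv k σ).toAlgHom := MvPolynomial.algHom_ext fun i => by
    rw [AlgHom.comp_apply, aeval_X]
    change _ = aeval v (rename σ (X i))
    rw [rename_X, aeval_X]; rfl
  rw [IsCoordinateSystem, this]
  exact hv.1.comp (renameEquiv k σ).bijective

/-- A homogeneous derivation of rank two kills a linear form that is part of a linear system of
variables. -/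
theorem exists_linearCoordinateSystem_apply_eq_zero
    {D : Derivation k (MvPolynomial (Fin 3) k) (MvPolynomial (Fin 3) k)} {d : ℕ}
    (hhom : IsHomogeneousOfDegree D d) (hrank : rank D = 2) :
    ∃ v, IsLinearCoordinateSystem v ∧ D (v 0) = 0 := by
  have hmem : rank D ∈ {r : ℕ | ∃ v : Fin 3 → MvPolynomial (Fin 3) k,
      IsCoordinateSystem v ∧ {i : Fin 3 | D (v i) ≠ 0}.ncard = r} := by
    -- The infimum of the empty set is 0, so rank two already shows that the set is nonempty.
    refine Nat.sInf_mem ?_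
    by_contra hne
    rw [Set.not_nonempty_iff_eq_empty] at hne
    rw [rank, hne, Nat.sInf_empty] at hrank
    omega
  obtain ⟨v, hv, hcard⟩ := hmem
  rw [hrank] at hcard
  obtain ⟨i, hi⟩ : ∃ i, D (v i) = 0 := by
    by_contra! hall
    have : {i : Fin 3 | D (v i) ≠ 0} = Set.univ := Set.eq_univ_of_forall hall
    rw [this, Set.ncard_univ, Nat.card_eq_fintype_card, Fintype.card_fin] at hcard
    omega
  obtain ⟨M, N, hMN, h⟩ := hv.exists_linearPart
  refine ⟨linearForms M ∘ Equiv.swap 0 i,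
    (isLinearCoordinateSystem_linearForms hMN).comp_perm _, ?_⟩
  rw [Function.comp_apply, Equiv.swap_apply_left, ← h, hhom.apply_homogeneousComponent, hi,
    map_zero]

theorem Dehom.swap {v : Fin 3 → MvPolynomial (Fin 3) k}
    {φ : MvPolynomial (Fin 3) k →ₐ[k] MvPolynomial (Fin 2) k} (h : Dehom v φ) :
    Dehom ![v 0, v 2, v 1] ((swapEquiv k).toAlgHom.comp φ) := by
  refine ⟨?_, ?_, ?_, ?_⟩
  · simpa using isLinearCoordinateSystem_block h.linear 0 1 1 0 (by simp)
  · change swapEquiv k (φ (v 0)) = 1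
    rw [h.zero, map_one]
  · change swapEquiv k (φ (v 2)) = X 0
    rw [h.two, swapEquiv_X_one]
  · change swapEquiv k (φ (v 1)) = X 1
    rw [h.one, swapEquiv_X_zero]

/-- A shear of degree one comes from a linear change: the term `-l * v 1` cancels the one the shear
adds to the image of `v 2`. -/
theorem Dehom.shear {v : Fin 3 → MvPolynomial (Fin 3) k}
    {φ : MvPolynomial (Fin 3) k →ₐ[k] MvPolynomial (Fin 2) k} (h : Dehom v φ) (l : k) :
    Dehom ![v 0, v 1, C (-l) * v 1 + v 2]
      ((PolyLND.shear (Polynomial.C l * Polynomial.X)).toAlgHom.comp φ) := by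
  refine ⟨?_, ?_, ?_, ?_⟩
  · simpa using isLinearCoordinateSystem_block h.linear 1 0 (-l) 1 (by simp)
  · change PolyLND.shear _ (φ (v 0)) = 1
    rw [h.zero, map_one]
  · change PolyLND.shear _ (φ (v 1)) = X 0
    rw [h.one, shear_X_zero]
  · change PolyLND.shear _ (φ (C (-l) * v 1 + v 2)) = X 1
    rw [map_add, map_mul, h.one, h.two, map_add, shear_X_one, map_mul, shear_X_zero,
      ← algebraMap_eq, AlgHom.commutes, AlgEquiv.commutes, map_mul, Polynomial.aeval_C,
      Polynomial.aeval_X, map_neg]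
    ring

end LinearChange

/-! ### Plane models and the normalization of the killed variable. -/

section Variables

variable {k : Type*} [Field k]

/-- `δ` is the derivation of the plane induced by `D` in the coordinates `v`, and `θ X₀` is a
variable that it kills. -/
structure IsPlaneModel (D : Derivation k (MvPolynomial (Fin 3) k) (MvPolynomial (Fin 3) k))
    (v : Fin 3 → MvPolynomial (Fin 3) k) (φ : MvPolynomial (Fin 3) k →ₐ[k] MvPolynomial (Fin 2) k)
    (δ : Derivation k (MvPolynomial (Fin 2) k) (MvPolynomial (Fin 2) k))
    (θ : MvPolynomial (Fin 2) k ≃ₐ[k] MvPolynomial (Fin 2) k) : Prop where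
  dehom : Dehom v φ
  apply_zero : D (v 0) = 0
  comm : ∀ b, φ (D b) = δ (φ b)
  apply_variable : δ (θ (X 0)) = 0

section

variable {D : Derivation k (MvPolynomial (Fin 3) k) (MvPolynomial (Fin 3) k)}
  {v : Fin 3 → MvPolynomial (Fin 3) k} {φ : MvPolynomial (Fin 3) k →ₐ[k] MvPolynomial (Fin 2) k}
  {δ : Derivation k (MvPolynomial (Fin 2) k) (MvPolynomial (Fin 2) k)}
  {θ : MvPolynomial (Fin 2) k ≃ₐ[k] MvPolynomial (Fin 2) k}

theorem IsPlaneModel.trans (h : IsPlaneModel D v φ δ θ)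
    (τ : MvPolynomial (Fin 2) k ≃ₐ[k] MvPolynomial (Fin 2) k) {v' : Fin 3 → MvPolynomial (Fin 3) k}
    (hv' : Dehom v' (τ.toAlgHom.comp φ)) (h0 : D (v' 0) = 0) :
    IsPlaneModel D v' (τ.toAlgHom.comp φ) (conj τ δ) (θ.trans τ) where
  dehom := hv'
  apply_zero := h0
  comm b := by
    change τ (φ (D b)) = conj τ δ (τ (φ b))
    rw [conj_apply_apply, h.comm]
  apply_variable := by
    rw [AlgEquiv.trans_apply, conj_apply_apply, h.apply_variable, map_zero]

theorem IsPlaneModel.swap (h : IsPlaneModel D v φ δ θ) :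
    IsPlaneModel D ![v 0, v 2, v 1] ((swapEquiv k).toAlgHom.comp φ) (conj (swapEquiv k) δ)
      (θ.trans (swapEquiv k)) :=
  h.trans _ h.dehom.swap h.apply_zero

end

/-- A variable that is a polynomial in one coordinate is linear in it. -/
theorem algEquiv_X_eq_of_degreeOf_eq_zero [IsAlgClosed k]
    (θ : MvPolynomial (Fin 2) k ≃ₐ[k] MvPolynomial (Fin 2) k) {i j : Fin 2} (hij : i ≠ j)
    (h : degreeOf j (θ (X 0)) = 0) :
    ∃ e l : k, e ≠ 0 ∧ θ (X 0) = C e * (X i - C l) := by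
  obtain ⟨u, hu⟩ := exists_eq_aeval_of_degreeOf_eq_zero hij h
  have hdeg : u.natDegree ≠ 0 := by
    intro h0
    rw [Polynomial.eq_C_of_natDegree_eq_zero h0, Polynomial.aeval_C] at hu
    have h1 : (X 0 : MvPolynomial (Fin 2) k) = C (u.coeff 0) := θ.injective (by
      rw [hu, ← algebraMap_eq, AlgEquiv.commutes])
    have := X_prime (R := k) (i := (0 : Fin 2))
    rw [h1] at this
    have h2 : u.coeff 0 ≠ 0 := by
      intro h3; rw [h3, C_0] at this; exact this.ne_zero rfl
    exact this.not_isUnit ((isUnit_iff_ne_zero.2 h2).map C)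
  obtain ⟨l, c, hc⟩ := X_sub_C_dvd_aeval (X i : MvPolynomial (Fin 2) k) hdeg
  rw [algebraMap_eq] at hc
  have hirr : Irreducible (θ (X 0)) :=
    (MulEquiv.irreducible_iff θ.toMulEquiv).2 X_prime.irreducible
  rw [hu, hc] at hirr
  rcases hirr.isUnit_or_isUnit rfl with hunit | hunit
  · have := hunit.map (aeval (fun _ => l) : MvPolynomial (Fin 2) k →ₐ[k] k)
    rw [map_sub, aeval_X, algHom_C] at this
    simp at this
  · obtain ⟨e, he, rfl⟩ := isUnit_iff_eq_C_of_isReduced.1 hunit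
    exact ⟨e, l, he.ne_zero, by rw [hu, hc, mul_comm]⟩

variable [CharZero k] [IsAlgClosed k]

/-- The linear system of variables can be chosen such that the variable killed by the plane
derivation has larger degree in the first variable. -/
theorem exists_planeModel_degreeOf_lt
    {D : Derivation k (MvPolynomial (Fin 3) k) (MvPolynomial (Fin 3) k)}
    (hD : IsLocallyNilpotent D) {d : ℕ} (hhom : IsHomogeneousOfDegree D d) (hirr : IsIrreducible D)
    {v : Fin 3 → MvPolynomial (Fin 3) k} (hv : IsLinearCoordinateSystem v) (hD0 : D (v 0) = 0) :
    ∃ v φ δ θ, IsPlaneModel D v φ δ θ ∧ degreeOf 1 (θ (X 0)) < degreeOf 0 (θ (X 0)) := by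
  obtain ⟨φ, hφ⟩ := exists_dehom hv
  obtain ⟨δ, hδ⟩ := hφ.exists_derivation hD0
  have hδn := hφ.locallyNilpotent hδ hD
  have hδi := hφ.isIrreducible hδ hhom hirr
  obtain ⟨θ, hθ⟩ := exists_variable_apply_eq_zero hδn hδi.ne_zero
  have hmodel : IsPlaneModel D v φ δ θ := ⟨hφ, hD0, hδ, hθ⟩
  rcases lt_trichotomy (degreeOf 1 (θ (X 0))) (degreeOf 0 (θ (X 0))) with hlt | heq | hgt
  · exact ⟨v, φ, δ, θ, hmodel, hlt⟩
  -- Equal partial degrees are nonzero because the total degree is d + 2. They force b = 1, so the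
  -- shear is linear and lowers only the y-degree; a swap then gives the right order.
  · have h1 : degreeOf 1 (θ (X 0)) ≠ 0 := by
      intro h1
      have h0 := heq ▸ h1
      obtain ⟨γ, hγ, hform⟩ := apply_eq_of_variable hδi θ hθ
      have htot := hφ.totalDegree_eq hδ hD0 hhom hirr hγ hform
      have hle : (θ (X 0)).totalDegree ≤ 0 := totalDegree_le_of_degree_le fun m hm => by
        have e0 := le_degreeOf hm 0
        have e1 := le_degreeOf hm 1
        rw [degree_fin_two]
        omega
      omega
    obtain ⟨b, l, hb, -, hm, -, e1, e0⟩ := exists_shear hδn hδi.ne_zero hθ h1 heq.le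
    obtain rfl : b = 1 := by
      rw [heq] at hm
      exact (Nat.eq_of_mul_eq_mul_left (by omega) ((mul_one _).trans hm)).symm
    rw [pow_one] at e0 e1
    refine ⟨_, _, _, _, (hmodel.trans _ (hφ.shear l) hD0).swap, ?_⟩
    rw [AlgEquiv.trans_apply, AlgEquiv.trans_apply, degreeOf_one_swapEquiv, degreeOf_zero_swapEquiv]
    omega
  · refine ⟨_, _, _, _, hmodel.swap, ?_⟩
    rw [AlgEquiv.trans_apply, degreeOf_one_swapEquiv, degreeOf_zero_swapEquiv]
    exact hgt

/-- Shears are composed until the y-degree falls below the z-degree, which never changes. The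
exponents used decrease strictly, so deg h is the first exponent and is read off the original
degrees. -/
theorem exists_shear_degreeOf_lt
    {δ : Derivation k (MvPolynomial (Fin 2) k) (MvPolynomial (Fin 2) k)}
    (hδ : IsLocallyNilpotent δ) (hδ0 : δ ≠ 0) {F : MvPolynomial (Fin 2) k} (hF : δ F = 0)
    (h1 : degreeOf 1 F ≠ 0) :
    ∃ h : Polynomial k, (degreeOf 0 F < degreeOf 1 F → h = 0) ∧
      (degreeOf 1 F ≤ degreeOf 0 F → h ≠ 0 ∧ degreeOf 0 F = degreeOf 1 F * h.natDegree) ∧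
      degreeOf 1 (shear h F) = degreeOf 1 F ∧ degreeOf 0 (shear h F) < degreeOf 1 F := by
  generalize hm : degreeOf 0 F = m
  induction m using Nat.strong_induction_on generalizing δ F with
  | _ m ih =>
  subst hm
  rcases lt_or_ge (degreeOf 0 F) (degreeOf 1 F) with hlt | hge
  · exact ⟨0, fun _ => rfl, fun h => absurd h (not_le.2 hlt), by rw [shear_zero],
      by rwa [shear_zero]⟩
  · obtain ⟨b, l, hb, hl, hmb, -, e1, e0⟩ := exists_shear hδ hδ0 hF h1 hge
    set q : Polynomial k := Polynomial.C l * Polynomial.X ^ b with hq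
    have hqd : q.natDegree = b := Polynomial.natDegree_C_mul_X_pow b l hl
    obtain ⟨h, hh0, hh1, f1, f0⟩ := ih _ e0 (conj_locallyNilpotent (shear q) hδ)
      (conj_ne_zero (shear q) hδ0) (F := shear q F) (by rw [conj_apply_apply, hF, map_zero])
      (by rwa [e1]) rfl
    rw [shear_shear, e1] at f1 f0
    have hdeg : h.natDegree < q.natDegree := by
      rw [hqd]
      rcases lt_or_ge (degreeOf 0 (shear q F)) (degreeOf 1 (shear q F)) with h2 | h2
      · rw [hh0 h2, Polynomial.natDegree_zero]; omega
      · have := (hh1 h2).2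
        rw [e1] at this
        refine Nat.lt_of_mul_lt_mul_left (a := degreeOf 1 F) ?_
        rw [← this, ← hmb]
        exact e0
    have hsum : (h + q).natDegree = b := by
      rw [Polynomial.natDegree_add_eq_right_of_natDegree_lt hdeg, hqd]
    refine ⟨h + q, fun h2 => absurd hge (not_le.2 h2), fun _ => ⟨?_, by rw [hsum, hmb]⟩, f1, f0⟩
    intro h0
    rw [h0, Polynomial.natDegree_zero] at hsum
    exact hb hsum.symm

end Variables

/-! ### From the plane variable back to D: triangular form or normal form. -/

section Final

variable {k : Type*} [Field k]

/-- In the coordinates v the first row of the determinant is (1, 0, 0), which leaves a 2 × 2 minor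
in y and z. -/
theorem Dehom.apply_jacobianDerivation {v : Fin 3 → MvPolynomial (Fin 3) k}
    {φ : MvPolynomial (Fin 3) k →ₐ[k] MvPolynomial (Fin 2) k} (h : Dehom v φ) :
    ∃ κ : k, κ ≠ 0 ∧ ∀ P b, φ (jacobianDerivation (v 0) P b) =
      C κ * (pderiv 0 (φ P) * pderiv 1 (φ b) - pderiv 1 (φ P) * pderiv 0 (φ b)) := by
  obtain ⟨κ, hκ, hdet⟩ := h.linear.det_eq
  refine ⟨κ, hκ, fun P b => ?_⟩
  obtain ⟨P, rfl⟩ := h.linear.1.2 P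
  obtain ⟨b, rfl⟩ := h.linear.1.2 b
  have h0 : v 0 = aeval v (X 0 : MvPolynomial (Fin 3) k) := by rw [aeval_X]
  have e0 : ∀ p : MvPolynomial (Fin 3) k,
      pderiv 0 (dehomogenize p) = dehomogenize (pderiv 1 p) := by
    intro p
    rw [dehomogenize, derivation_aeval, Fin.sum_univ_three]
    simp
  have e1 : ∀ p : MvPolynomial (Fin 3) k,
      pderiv 1 (dehomogenize p) = dehomogenize (pderiv 2 p) := by
    intro p
    rw [dehomogenize, derivation_aeval, Fin.sum_univ_three]
    simp
  conv_lhs => rw [h0]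
  rw [jacobianDerivation_aeval, hdet, map_mul, h.apply_aeval, h.apply_aeval, h.apply_aeval, e0, e0,
    e1, e1, ← algebraMap_eq, AlgHom.commutes, algebraMap_eq]
  congr 1
  simp [jacobianDerivation]
  ring

theorem jacobianDerivation_isHomogeneous {f g b : MvPolynomial (Fin 3) k} {l m n : ℕ}
    (hf : f.IsHomogeneous l) (hg : g.IsHomogeneous m) (hb : b.IsHomogeneous n) :
    (jacobianDerivation f g b).IsHomogeneous (l - 1 + (m - 1) + (n - 1)) := by
  simp only [jacobianDerivation, Derivation.add_apply, Derivation.smul_apply, smul_eq_mul]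
  exact ((((hf.pderiv.mul hg.pderiv).sub (hf.pderiv.mul hg.pderiv)).mul hb.pderiv).add
    (((hf.pderiv.mul hg.pderiv).sub (hf.pderiv.mul hg.pderiv)).mul hb.pderiv)).add
    (((hf.pderiv.mul hg.pderiv).sub (hf.pderiv.mul hg.pderiv)).mul hb.pderiv)

theorem derivation_eq_of_coordinates {v : Fin 3 → MvPolynomial (Fin 3) k}
    (hv : IsCoordinateSystem v)
    {D E : Derivation k (MvPolynomial (Fin 3) k) (MvPolynomial (Fin 3) k)}
    (h : ∀ i, D (v i) = E (v i)) : D = E := by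
  refine Derivation.ext fun b => ?_
  obtain ⟨p, rfl⟩ := hv.2 b
  rw [derivation_aeval, derivation_aeval]
  simp only [h]

/-- Homogenizing the images of y and z puts D v₁ in k[v₀] and D v₂ in k[v₀, v₁]; the bound on deg u
makes the second homogenization possible. -/
theorem isTriangularizable_of_variable_eq
    {D : Derivation k (MvPolynomial (Fin 3) k) (MvPolynomial (Fin 3) k)}
    {v : Fin 3 → MvPolynomial (Fin 3) k} {φ : MvPolynomial (Fin 3) k →ₐ[k] MvPolynomial (Fin 2) k}
    {δ : Derivation k (MvPolynomial (Fin 2) k) (MvPolynomial (Fin 2) k)} (hv : Dehom v φ)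
    (h0 : D (v 0) = 0) (hδ : ∀ b, φ (D b) = δ (φ b)) {d : ℕ} (hhom : IsHomogeneousOfDegree D d)
    {a : k} {u : Polynomial k} (hX0 : δ (X 0) = C a) (hX1 : δ (X 1) = Polynomial.aeval (X 0) u)
    (hu : u.natDegree ≤ 1 + d) : IsTriangularizable D := by
  have hN : ∀ i, (D (v i)).IsHomogeneous (1 + d) := fun i => hhom 1 _ (hv.linear.2 i)
  have h1 : D (v 1) = C a * v 0 ^ (1 + d) := by
    refine hv.eq_of_apply_eq (hN 1) ?_ ?_
    · simpa using ((hv.linear.2 0).pow (1 + d)).C_mul a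
    · rw [hδ, hv.one, hX0, map_mul, map_pow, hv.zero, one_pow, mul_one, ← algebraMap_eq,
        ← algebraMap_eq, AlgHom.commutes]
  have h2 : D (v 2) = ∑ i ∈ Finset.range (1 + d + 1),
      C (u.coeff i) * (v 0 ^ (1 + d - i) * v 1 ^ i) := by
    refine hv.eq_of_apply_eq (hN 2) (IsHomogeneous.sum _ _ _ fun i hi => ?_) ?_
    · have := (((hv.linear.2 0).pow (1 + d - i)).mul ((hv.linear.2 1).pow i)).C_mul (u.coeff i)
      rw [Finset.mem_range] at hi
      rwa [one_mul, one_mul, Nat.sub_add_cancel (by omega)] at this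
    · rw [hδ, hv.two, hX1, Polynomial.aeval_eq_sum_range' (Nat.lt_succ_of_le hu), map_sum]
      refine Finset.sum_congr rfl fun i _ => ?_
      rw [map_mul, map_mul, map_pow, map_pow, hv.zero, hv.one, one_pow, one_mul, ← algebraMap_eq,
        AlgHom.commutes, Algebra.smul_def]
  refine ⟨v, hv.linear.1, fun i => ?_⟩
  have hmem : ∀ {i j : Fin 3}, j < i → v j ∈ Algebra.adjoin k (v '' {j | j < i}) :=
    fun hji => Algebra.subset_adjoin ⟨_, hji, rfl⟩
  have hC : ∀ {i : Fin 3} (c : k), (C c : MvPolynomial (Fin 3) k) ∈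
      Algebra.adjoin k (v '' {j | j < i}) := fun c => Subalgebra.algebraMap_mem _ c
  fin_cases i
  · change D (v 0) ∈ _
    rw [h0]
    exact zero_mem _
  · change D (v 1) ∈ _
    rw [h1]
    exact mul_mem (hC _) (pow_mem (hmem (by decide)) _)
  · change D (v 2) ∈ _
    rw [h2]
    exact sum_mem fun i _ => mul_mem (hC _)
      (mul_mem (pow_mem (hmem (by decide)) _) (pow_mem (hmem (by decide)) _))

theorem coeff_single_aeval_X {n : ℕ} (i : Fin n) (u : Polynomial k) (m : ℕ) :
    coeff (Finsupp.single i m) (Polynomial.aeval (X i : MvPolynomial (Fin n) k) u) = u.coeff m := by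
  classical
  induction u using Polynomial.induction_on' with
  | add p q hp hq => rw [map_add, coeff_add, hp, hq, Polynomial.coeff_add]
  | monomial l a =>
    rw [Polynomial.aeval_monomial, algebraMap_eq, X_pow_eq_monomial, C_mul_monomial, mul_one,
      coeff_monomial, Polynomial.coeff_monomial]
    simp only [Finsupp.single_injective i |>.eq_iff]

theorem normalP_isHomogeneous {r s : ℕ} (hr : 1 ≤ r) (hs : 1 ≤ s) {h : MvPolynomial (Fin 2) k}
    (hh : h.IsHomogeneous s) (c : ℕ → k) {X Y Z : MvPolynomial (Fin 3) k} (hX : X.IsHomogeneous 1)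
    (hY : Y.IsHomogeneous 1) (hZ : Z.IsHomogeneous 1) :
    (normalP r s h c X Y Z).IsHomogeneous (r * s) := by
  have hT : (tildeZ s h X Y Z).IsHomogeneous s := by
    refine (aeval_isHomogeneous (fun i => ?_) hh).add ?_
    · fin_cases i
      · exact hX
      · exact hY
    · have := (hX.pow (s - 1)).mul hZ
      rwa [one_mul, Nat.sub_add_cancel hs] at this
  refine ((?_ : IsHomogeneous _ _).add (IsHomogeneous.sum _ _ _ fun i hi => ?_)).add ?_
  · rw [mul_comm r s]; exact hT.pow r
  · rw [Finset.mem_Icc] at hi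
    have := ((hX.pow (i * s)).C_mul (c i)).mul (hT.pow (r - i))
    have e : 1 * (i * s) + s * (r - i) = r * s := by
      rw [one_mul, mul_comm s, ← add_mul]; congr 1; omega
    rwa [e] at this
  · have := ((hX.pow (r * s - 1)).C_mul (c r)).mul hY
    rwa [one_mul, Nat.sub_add_cancel (Nat.mul_pos hr hs)] at this

theorem sum_range_succ_eq_Icc {M : Type*} [AddCommMonoid M] (f : ℕ → M) {r : ℕ} (hr : 1 ≤ r) :
    ∑ j ∈ Finset.range (r + 1), f j = f r + ∑ i ∈ Finset.Icc 1 (r - 1), f (r - i) + f 0 := by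
  obtain ⟨r, rfl⟩ := Nat.exists_eq_add_of_le' hr
  have : ∑ i ∈ Finset.range r, f (i + 1) = ∑ i ∈ Finset.Icc 1 (r + 1 - 1), f (r + 1 - i) := by
    refine Finset.sum_nbij' (fun i => r - i) (fun i => r - i) ?_ ?_ ?_ ?_ ?_ <;>
      intro i hi <;> simp only [Finset.mem_range, Finset.mem_Icc] at hi ⊢
    · omega
    · omega
    · omega
    · omega
    · congr 1; omega
  rw [Finset.sum_range_succ, Finset.sum_range_succ', this]
  abel

theorem eq_or_eq_of_mul_eq_mul {p q r s : ℕ} (hp : p.Prime) (hq : q.Prime) (hr : 2 ≤ r)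
    (hs : 2 ≤ s) (h : r * s = p * q) : (r = p ∧ s = q) ∨ (r = q ∧ s = p) := by
  have hpd : p ∣ r * s := h ▸ dvd_mul_right p q
  rcases hp.dvd_mul.1 hpd with ⟨t, rfl⟩ | ⟨t, rfl⟩
  · have : t * s = q := Nat.eq_of_mul_eq_mul_left hp.pos (by rw [← h]; ring)
    rcases (Nat.prime_mul_iff.1 (this ▸ hq)) with ⟨_, h1⟩ | ⟨_, h1⟩
    · omega
    · subst h1; left; simp_all
  · have : r * t = q := Nat.eq_of_mul_eq_mul_left hp.pos (by rw [← h]; ring)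
    rcases (Nat.prime_mul_iff.1 (this ▸ hq)) with ⟨_, h1⟩ | ⟨_, h1⟩
    · subst h1; right; simp_all
    · omega

/-- A variable of the plane of the form `c y + u(z - h(y))` comes from a normal form. -/
theorem exists_isNormalForm {r s : ℕ} (hr : 1 ≤ r) (hs : 1 ≤ s)
    {D : Derivation k (MvPolynomial (Fin 3) k) (MvPolynomial (Fin 3) k)}
    {v : Fin 3 → MvPolynomial (Fin 3) k} {φ : MvPolynomial (Fin 3) k →ₐ[k] MvPolynomial (Fin 2) k}
    {δ : Derivation k (MvPolynomial (Fin 2) k) (MvPolynomial (Fin 2) k)} (hv : Dehom v φ)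
    (hδ : ∀ b, φ (D b) = δ (φ b)) {d : ℕ} (hhom : IsHomogeneousOfDegree D d)
    (hd : d + 2 = r * s) {g : MvPolynomial (Fin 2) k} {γ : k} (hγ : γ ≠ 0)
    (hg : ∀ p, δ p = C γ * (pderiv 0 g * pderiv 1 p - pderiv 1 g * pderiv 0 p))
    {c : k} (hc : c ≠ 0) {u h : Polynomial k} (hu0 : u ≠ 0) (hur : u.natDegree = r)
    (hh0 : h ≠ 0) (hhs : h.natDegree = s)
    (hgu : g = C c * X 0 + Polynomial.aeval (X 1 - Polynomial.aeval (X 0) h) u) :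
    ∃ (γ : k) (H : MvPolynomial (Fin 2) k) (c : ℕ → k) (X Y Z : MvPolynomial (Fin 3) k),
      IsNormalForm r s D γ H c X Y Z := by
  set a := h.leadingCoeff with ha
  have ha0 : a ≠ 0 := Polynomial.leadingCoeff_ne_zero.2 hh0
  -- K is the coefficient of ζ^r in g, where z - h(y) = -a ζ and ζ is the image of Z̃. Dividing by
  -- it makes P monic in Z̃.
  set K : k := u.coeff r * (-a) ^ r with hK
  have hK0 : K ≠ 0 := mul_ne_zero (by
    rw [← hur]; exact Polynomial.leadingCoeff_ne_zero.2 hu0) (pow_ne_zero _ (neg_ne_zero.2 ha0))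
  let H : MvPolynomial (Fin 2) k := ∑ i ∈ Finset.range (s + 1),
    monomial (Finsupp.single 0 (s - i) + Finsupp.single 1 i) (h.coeff i / a)
  let cs : ℕ → k := fun i => if i = r then c / K else u.coeff (r - i) * (-a) ^ (r - i) / K
  -- Rescaling by -1/a compensates for dividing h by its leading coefficient, as monicity of H in Y
  -- requires.
  set Z' := C (-a⁻¹) * v 2 with hZ'
  have hlin : IsLinearCoordinateSystem ![v 0, v 1, Z'] := by
    have := isLinearCoordinateSystem_block hv.linear 1 0 0 (-a⁻¹) (by simpa using ha0)
    simpa only [C_1, one_mul, C_0, zero_mul, add_zero, zero_add] using this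
  have hHhom : H.IsHomogeneous s := IsHomogeneous.sum _ _ _ fun i hi => by
    refine isHomogeneous_monomial _ ?_
    rw [Finset.mem_range] at hi
    rw [degree_fin_two]
    simp
    omega
  have hHmonic : H.coeff (Finsupp.single 1 s) = 1 := by
    classical
    rw [coeff_sum, Finset.sum_eq_single s]
    · rw [coeff_monomial, if_pos (by simp), ← hhs]
      exact div_self ha0
    · intro i _ his
      rw [coeff_monomial, if_neg]
      intro he
      have := DFunLike.congr_fun he 1
      simp at this
      exact his this
    · simp
  set P := normalP r s H cs (v 0) (v 1) Z' with hP
  have hPhom : P.IsHomogeneous (r * s) :=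
    normalP_isHomogeneous hr hs hHhom cs (hv.linear.2 0) (hv.linear.2 1) (hlin.2 2)
  have hφC : ∀ x : k, φ (C x) = C x := fun x => by
    rw [← algebraMap_eq, AlgHom.commutes, algebraMap_eq]
  set ζ := φ (tildeZ s H (v 0) (v 1) Z') with hζ
  have hHφ : φ (aeval ![v 0, v 1] H) = C a⁻¹ * Polynomial.aeval (X 0) h := by
    rw [Polynomial.aeval_eq_sum_range, hhs, Finset.mul_sum, map_sum, map_sum]
    refine Finset.sum_congr rfl fun i _ => ?_
    rw [aeval_monomial, Finsupp.prod_fintype _ _ (by simp), Fin.prod_univ_two, algebraMap_eq,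
      map_mul, hφC, map_mul, map_pow, map_pow]
    simp only [Matrix.cons_val_zero, Matrix.cons_val_one, hv.zero, hv.one, one_pow, one_mul,
      smul_eq_C_mul, div_eq_inv_mul, C_mul]
    simp [mul_assoc]
  have hζ' : X 1 - Polynomial.aeval (X 0) h = C (-a) * ζ := by
    have hCa : (C a * C a⁻¹ : MvPolynomial (Fin 2) k) = 1 := by
      rw [← C_mul, mul_inv_cancel₀ ha0, C_1]
    rw [hζ, tildeZ, map_add, hHφ, map_mul, map_pow, hv.zero, one_pow, hZ', map_mul, hφC, hv.two,
      C_neg, C_neg]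
    linear_combination (Polynomial.aeval (X 0) h - X 1) * hCa
  -- The constant term of u has no place in P, but it disappears on differentiation.
  have hgP : g = C K * φ P + C (u.coeff 0) := by
    have hterm : ∀ j, u.coeff j • (C (-a) * ζ) ^ j = C (u.coeff j * (-a) ^ j) * ζ ^ j := by
      intro j
      rw [smul_eq_C_mul, mul_pow, C_mul, C_pow]; ring
    have hmid : ∀ i ∈ Finset.Icc 1 (r - 1), C (u.coeff (r - i) * (-a) ^ (r - i)) * ζ ^ (r - i) =
        C K * (C (cs i) * ζ ^ (r - i)) := by
      intro i hi
      rw [Finset.mem_Icc] at hi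
      have : cs i = u.coeff (r - i) * (-a) ^ (r - i) / K := if_neg (by omega)
      rw [this, ← mul_assoc, ← C_mul, mul_div_cancel₀ _ hK0]
    have hlast : (C c : MvPolynomial (Fin 2) k) = C K * C (cs r) := by
      have : cs r = c / K := if_pos rfl
      rw [this, ← C_mul, mul_div_cancel₀ _ hK0]
    have hφP : φ P = ζ ^ r + ∑ i ∈ Finset.Icc 1 (r - 1), C (cs i) * ζ ^ (r - i) +
        C (cs r) * X 0 := by
      rw [hP, normalP]
      simp only [map_add, map_sum, map_mul, map_pow, hφC, hv.zero, hv.one, one_pow, mul_one, ← hζ]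
    rw [hgu, hζ', Polynomial.aeval_eq_sum_range, hur]
    simp only [hterm]
    rw [sum_range_succ_eq_Icc _ hr, Finset.sum_congr rfl hmid, ← Finset.mul_sum, hφP, hlast, ← hK]
    simp
    ring
  obtain ⟨κ, hκ, hjac⟩ := hv.apply_jacobianDerivation
  have hDeq : D = (γ * K / κ) • jacobianDerivation (v 0) P := by
    have hκC : (C κ * C κ⁻¹ : MvPolynomial (Fin 2) k) = 1 := by
      rw [← C_mul, mul_inv_cancel₀ hκ, C_1]
    have hcoord : ∀ i, D (v i) = (γ * K / κ) • jacobianDerivation (v 0) P (v i) := by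
      intro i
      refine hv.eq_of_apply_eq (hhom 1 _ (hv.linear.2 i)) ?_ ?_
      · have := (jacobianDerivation_isHomogeneous (hv.linear.2 0) hPhom (hv.linear.2 i)).C_mul
          (γ * K / κ)
        rw [smul_eq_C_mul]
        have e : 1 - 1 + (r * s - 1) + (1 - 1) = 1 + d := by omega
        rwa [e] at this
      · have hCC : (C (γ * K / κ) : MvPolynomial (Fin 2) k) = C γ * C K * C κ⁻¹ := by
          rw [div_eq_mul_inv, RingHom.map_mul C, RingHom.map_mul C γ K]
        rw [map_smul, hδ, hg, hjac, hgP, smul_eq_C_mul, hCC]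
        simp only [map_add, pderiv_C_mul, pderiv_C, add_zero]
        linear_combination (-(C γ * C K * (pderiv 0 (φ P) * pderiv 1 (φ (v i)) -
          pderiv 1 (φ P) * pderiv 0 (φ (v i))))) * hκC
    exact derivation_eq_of_coordinates hv.linear.1 hcoord
  refine ⟨γ * K / κ, H, cs, v 0, v 1, Z', hlin, div_ne_zero (mul_ne_zero hγ hK0) hκ, hHhom,
    hHmonic, ?_, hDeq⟩
  have : cs r = c / K := if_pos rfl
  rw [this]
  exact div_ne_zero hc hK0

variable [CharZero k] [IsAlgClosed k]

theorem exists_isNormalForm_of_not_isTriangularizable {p q : ℕ} (hp : p.Prime) (hq : q.Prime)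
    {D : Derivation k (MvPolynomial (Fin 3) k) (MvPolynomial (Fin 3) k)}
    (hD : IsLocallyNilpotent D) (hirr : IsIrreducible D)
    (hhom : IsHomogeneousOfDegree D (p * q - 2)) (hrank : rank D = 2)
    (htri : ¬ IsTriangularizable D) :
    ∃ r s : ℕ, ((r = p ∧ s = q) ∨ (r = q ∧ s = p)) ∧
      ∃ (γ : k) (h : MvPolynomial (Fin 2) k) (c : ℕ → k) (X Y Z : MvPolynomial (Fin 3) k),
        IsNormalForm r s D γ h c X Y Z := by
  obtain ⟨v₀, hv₀, hDv₀⟩ := exists_linearCoordinateSystem_apply_eq_zero hhom hrank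
  obtain ⟨v, φ, δ, θ, hmodel, hlt⟩ := exists_planeModel_degreeOf_lt hD hhom hirr hv₀ hDv₀
  obtain ⟨hv, h0, hδ, hθ⟩ := hmodel
  have hδn := hv.locallyNilpotent hδ hD
  have hδi := hv.isIrreducible hδ hhom hirr
  obtain ⟨γ, hγ, hg⟩ := apply_eq_of_variable hδi θ hθ
  have htot := hv.totalDegree_eq hδ h0 hhom hirr hγ hg
  have hpq : 4 ≤ p * q := Nat.mul_le_mul hp.two_le hq.two_le
  rw [Nat.sub_add_cancel (by omega)] at htot
  set g := θ (X 0) with hgdef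
  -- A variable free of z is linear in y, whereas deg g = pq ≥ 4.
  have hr0 : degreeOf 1 g ≠ 0 := by
    intro hz
    obtain ⟨e, l, -, he⟩ := algEquiv_X_eq_of_degreeOf_eq_zero θ (i := 0) (j := 1) (by decide) hz
    have : g.totalDegree ≤ 1 := by
      rw [hgdef, he]
      refine (totalDegree_mul _ _).trans ?_
      have := totalDegree_sub_C_le (X 0 : MvPolynomial (Fin 2) k) l
      rw [totalDegree_X] at this
      simpa using this
    omega
  obtain ⟨-, -, -, -, -, htot', -⟩ := exists_shear hδn hδi.ne_zero hθ hr0 hlt.le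
  obtain ⟨h, -, hh, f1, f0⟩ := exists_shear_degreeOf_lt hδn hδi.ne_zero hθ hr0
  obtain ⟨hh0, hm⟩ := hh hlt.le
  rw [← htot', htot] at hm
  set r := degreeOf 1 g with hr
  set s := h.natDegree with hs
  have hgF : g = shear (-h) (shear h g) := by
    rw [shear_shear, neg_add_cancel, shear_zero]
  -- If the sheared variable does not involve y, it is linear in z; then g is a multiple of z - h(y)
  -- - l and D is triangular.
  by_cases hz : degreeOf 0 (shear h g) = 0
  · refine absurd ?_ htri
    obtain ⟨e, l, -, he⟩ := algEquiv_X_eq_of_degreeOf_eq_zero (θ.trans (shear h)) (i := 1) (j := 0)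
      (by decide) hz
    rw [AlgEquiv.trans_apply, ← hgdef] at he
    have hge : g = C e * (X 1 - Polynomial.aeval (X 0) h - C l) := by
      rw [hgF, he, map_mul, map_sub, shear_X_one, ← algebraMap_eq, AlgEquiv.commutes,
        AlgEquiv.commutes, map_neg]
      ring
    have hle : s ≤ p * q := by
      rw [hm]
      exact Nat.le_mul_of_pos_left _ (Nat.pos_of_ne_zero hr0)
    refine isTriangularizable_of_variable_eq hv h0 hδ hhom (a := -(γ * e))
      (u := Polynomial.C (-(γ * e)) * Polynomial.derivative h) ?_ ?_ ?_
    · rw [hg, hge]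
      simp [Derivation.leibniz, Derivation.map_aeval]
    · rw [hg, hge]
      simp [Derivation.leibniz, Derivation.map_aeval, algebraMap_eq]
      ring
    · refine (Polynomial.natDegree_C_mul_le _ _).trans
        ((Polynomial.natDegree_derivative_le _).trans ?_)
      omega
  · have hδs := conj_locallyNilpotent (shear h) hδn
    have hδs0 := conj_ne_zero (shear h) hδi.ne_zero
    have hker : conj (shear h) δ (shear h g) = 0 := by rw [conj_apply_apply, hθ, map_zero]
    -- After swapping, the Newton polygon argument shows that the y-degree of the sheared variable
    -- divides r.
    obtain ⟨b, -, -, -, hrb, -⟩ := exists_shear (δ := conj (swapEquiv k) (conj (shear h) δ))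
      (conj_locallyNilpotent _ hδs) (conj_ne_zero _ hδs0) (F := swapEquiv k (shear h g))
      (by rw [conj_apply_apply, hker, map_zero]) (by rwa [degreeOf_one_swapEquiv])
      (by rw [degreeOf_one_swapEquiv, degreeOf_zero_swapEquiv]; omega)
    rw [degreeOf_one_swapEquiv, degreeOf_zero_swapEquiv, f1] at hrb
    have hr2 : 2 ≤ r := by omega
    -- s ≤ 1 would give deg_y g ≤ deg_z g, against the choice of coordinates.
    have hs2 : 2 ≤ s := by
      by_contra! hlt2
      have : r * s ≤ r * 1 := Nat.mul_le_mul_left _ (by omega)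
      omega
    have hcases := eq_or_eq_of_mul_eq_mul hp hq hr2 hs2 hm.symm
    have hrp : r.Prime := by
      rcases hcases with ⟨h1, -⟩ | ⟨h1, -⟩ <;> rw [h1] <;> assumption
    have hm1 : degreeOf 0 (shear h g) = 1 := by
      rcases hrp.eq_one_or_self_of_dvd _ ⟨b, hrb⟩ with h1 | h1
      · exact h1
      · omega
    set F := shear h g with hF
    have hc := coeff_single_degreeOf_ne_zero hδs hδs0 hker (i := 0) (j := 1) (by decide) hz
    rw [hm1] at hc
    have hrc := coeff_single_degreeOf_ne_zero hδs hδs0 hker (i := 1) (j := 0) (by decide)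
      (by omega)
    rw [f1] at hrc
    set c := coeff (Finsupp.single 0 1) F with hcdef
    -- The y-degree of F is 1, and a monomial attaining it contains no z, so y is the only monomial
    -- of F involving y.
    have hdeg0 : degreeOf 0 (F - C c * X 0) = 0 := by
      classical
      refine Nat.le_zero.1 (degreeOf_le_iff.2 fun m hm => ?_)
      rw [mem_support_iff, coeff_sub, coeff_C_mul, coeff_X] at hm
      by_contra hm0
      by_cases hm1' : m = Finsupp.single 0 1
      · rw [hm1'] at hm
        simp [hcdef] at hm
      · rw [if_neg (Ne.symm hm1'), mul_zero, sub_zero] at hm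
        have hle := le_degreeOf hm 0
        have hm01 : m 0 = 1 := by omega
        have hm11 := eq_zero_of_eq_degreeOf hδs hδs0 hker (i := 0) (j := 1) (by decide) hz hm
          (by omega)
        refine hm1' (Finsupp.ext fun i => ?_)
        fin_cases i
        · simpa using hm01
        · simpa using hm11
    obtain ⟨u, hu⟩ := exists_eq_aeval_of_degreeOf_eq_zero (i := 1) (j := 0) (by decide) hdeg0
    have hucoeff : ∀ i, u.coeff i = coeff (Finsupp.single 1 i) F := by
      classical
      intro i
      rw [← coeff_single_aeval_X (1 : Fin 2) u i, ← hu, coeff_sub, coeff_C_mul, coeff_X, if_neg]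
      · simp
      · intro he
        have := DFunLike.congr_fun he 0
        simp at this
    have hur : u.natDegree = r := by
      refine le_antisymm (Polynomial.natDegree_le_iff_coeff_eq_zero.2 fun N hN => ?_) ?_
      · rw [hucoeff]
        by_contra hne
        have := le_degreeOf hne 1
        simp at this
        omega
      · exact Polynomial.le_natDegree_of_ne_zero (by rwa [hucoeff])
    have hu0 : u ≠ 0 := by
      rintro rfl
      rw [Polynomial.natDegree_zero] at hur
      omega
    have hgu : g = C c * X 0 + Polynomial.aeval (X 1 - Polynomial.aeval (X 0) h) u := by
      have : F = C c * X 0 + Polynomial.aeval (X 1) u := by rw [← hu]; ring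
      rw [hgF, this, map_add, map_mul, shear_X_zero, ← algebraMap_eq, AlgEquiv.commutes,
        ← Polynomial.aeval_algHom_apply, shear_X_one, map_neg, sub_eq_add_neg]
    exact ⟨r, s, hcases, exists_isNormalForm (by omega) (by omega) hv hδ hhom (by omega) hγ hg
      hc hu0 hur hh0 hs.symm hgu⟩

end Final

end PolyLND

/-! ### The equivalence and the degree formulas. -/

theorem mainTheorem9 {k : Type*} [Field k] [CharZero k] [IsAlgClosed k]
    (p q : ℕ) (hp : p.Prime) (hq : q.Prime)
    (D : Derivation k (MvPolynomial (Fin 3) k) (MvPolynomial (Fin 3) k))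
    (hD : PolyLND.IsLocallyNilpotent D)
    (hirr : PolyLND.IsIrreducible D)
    (hhom : PolyLND.IsHomogeneousOfDegree D (p * q - 2))
    (hrank : PolyLND.rank D = 2) :
    (¬ PolyLND.IsTriangularizable D ↔
      ∃ (p' q' : ℕ), ((p' = p ∧ q' = q) ∨ (p' = q ∧ q' = p)) ∧
        ∃ (γ : k) (h : MvPolynomial (Fin 2) k) (c : ℕ → k) (X Y Z : MvPolynomial (Fin 3) k),
          PolyLND.IsNormalForm p' q' D γ h c X Y Z ∧
          PolyLND.degD D X = 0 ∧ 0 < PolyLND.degD D Y ∧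
          PolyLND.degD D Y < PolyLND.degD D Z) ∧
    (∀ (p' q' : ℕ), ((p' = p ∧ q' = q) ∨ (p' = q ∧ q' = p)) →
      ∀ (γ : k) (h : MvPolynomial (Fin 2) k) (c : ℕ → k) (X Y Z : MvPolynomial (Fin 3) k),
        PolyLND.IsNormalForm p' q' D γ h c X Y Z →
          PolyLND.degD D X = 0 ∧
          PolyLND.degD D Y = (p' : WithBot ℕ) ∧
          PolyLND.degD D Z = ((p' * q' : ℕ) : WithBot ℕ)) := by
  have htwo : ∀ {p' q' : ℕ}, ((p' = p ∧ q' = q) ∨ (p' = q ∧ q' = p)) → 2 ≤ p' ∧ 2 ≤ q' := by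
    rintro p' q' (⟨rfl, rfl⟩ | ⟨rfl, rfl⟩)
    · exact ⟨hp.two_le, hq.two_le⟩
    · exact ⟨hq.two_le, hp.two_le⟩
  have hdeg : ∀ (p' q' : ℕ), ((p' = p ∧ q' = q) ∨ (p' = q ∧ q' = p)) →
      ∀ (γ : k) (h : MvPolynomial (Fin 2) k) (c : ℕ → k) (X Y Z : MvPolynomial (Fin 3) k),
        PolyLND.IsNormalForm p' q' D γ h c X Y Z →
          PolyLND.degD D X = 0 ∧
          PolyLND.degD D Y = (p' : WithBot ℕ) ∧
          PolyLND.degD D Z = ((p' * q' : ℕ) : WithBot ℕ) := by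
    intro p' q' hpq γ h c X Y Z H
    obtain ⟨hX, hY, hZ⟩ := H.hasTop (htwo hpq).1 (htwo hpq).2 hD
    exact ⟨PolyLND.degD_eq_of_hasTop hX, PolyLND.degD_eq_of_hasTop hY,
      PolyLND.degD_eq_of_hasTop hZ⟩
  refine ⟨⟨fun htri => ?_, ?_⟩, hdeg⟩
  · obtain ⟨p', q', hpq, γ, h, c, X, Y, Z, H⟩ :=
      PolyLND.exists_isNormalForm_of_not_isTriangularizable hp hq hD hirr hhom hrank htri
    obtain ⟨h1, h2, h3⟩ := hdeg p' q' hpq γ h c X Y Z H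
    obtain ⟨hp', hq'⟩ := htwo hpq
    refine ⟨p', q', hpq, γ, h, c, X, Y, Z, H, h1, ?_, ?_⟩
    · rw [h2]
      exact_mod_cast (by omega : 0 < p')
    · rw [h2, h3]
      exact_mod_cast (by nlinarith : p' < p' * q')
  · rintro ⟨p', q', hpq, γ, h, c, X, Y, Z, H, -⟩
    -- The degree pq - 2 is positive, which the argument against triangularizability needs.
    have h4 : 4 ≤ p * q := Nat.mul_le_mul hp.two_le hq.two_le
    obtain ⟨hp', hq'⟩ := htwo hpq
    by_cases hd : 0 < p * q - 2
    · exact H.not_isTriangularizable hp' hq' hD hd hhom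
    · omega
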